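/- Setting. Let $\mathcal X$ be a measurable space, $\mathcal Y=\{-1,1\}$, and let $\mathcal H\subseteq\mathcal Y^{\mathcal X}$ be a class of measurable functions of finite VC dimension $d$. Let $\mathcal A$ be any ERM learner for $\mathcal H$: for every finite sequence $S$ in $\mathcal X\times\mathcal Y$, $\mathcal A(S)\in\mathcal H$ makes the least possible number of errors on $S$ among the members of $\mathcal H$; the learner is measurable in the sense that $(S,x)\mapsto\mathcal A(S)(x)$ is jointly measurable on $(\mathcal X\times\mathcal Y)^n\times\mathcal X$ for every $n$. For a probability distribution $\mathcal D$ on $\mathcal X\times\mathcal Y$ put $\tau=\inf_{h\in\mathcal H}\Pr_{(x,y)\sim\mathcal D}[h(x)\neq y]$. Splitting. For finite sequences $S,T$ in $\mathcal X\times\mathcal Y$ with $|S|=3^k$, define a list $\mathcal S(S;T)$ of training sequences recursively ($\sqcup$ is concatenation). If $k<6$, $\mathcal S(S;T)$ has the single entry $S\sqcup T$. If $k\ge 6$, cut $S$ into $27$ consecutive blocks $S_1,\dots,S_{27}$ of length $3^{k-3}$, let $S_{i,\sqcup}$ be the first $3^{k-6}$ entries of $S_i$ and $S_{i,\sqcap}$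 the remaining ones, and let $\mathcal S(S;T)$ be the concatenation of the lists $\mathcal S(S_{i,\sqcup};\,S_{i,\sqcap}\sqcup T)$, $i=1,\dots,27$. Let $\widehat{\mathcal A}_{\mathbf t}(S)=(\hat h_1,\dots,\hat h_t)$ be $t$ hypotheses drawn independently and uniformly, with replacement, from the multiset $\{\mathcal A(S')\}_{S'\in\mathcal S(S;\emptyset)}$. Theorem. There is a universal constant $c\ge 1$ such that for all $\mathcal X,\mathcal H,d,\mathcal A,\mathcal D$ as above, every $0<\delta<1$, every $m=3^k$ with $k\ge 6$, and every natural number $$t\ \ge\ 4\cdot 243^2\,\ln\!\left(\frac{2m}{\delta\,(d+\ln(1/\delta))}\right),$$ with probability at least $1-\delta$ over $\mathbf S\sim\mathcal D^m$ and the independent draw of the $t$ hypotheses of $\widehat{\mathcal A}_{\mathbf t}(\mathbf S)$, $$\Pr_{(x,y)\sim\mathcal D}\!\left[\frac1t\sum_{i=1}^t\mathbf 1\{\hat h_i(x)\ne y\}\ \ge\ \frac{11}{243}\right]\ \le\ c\,\tau+\frac{c\,(d+\ln(e/\delta))}{m}.$$ (For $t=0$, which the condition allows only when $\delta(d+\ln(1/\delta))\ge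 2m$, the average is read as $0$.) -/

import Mathlib

open MeasureTheory ProbabilityTheory

noncomputable section

namespace AgnosticVoting

/-- The label set `{-1, 1}`. -/
abbrev Label : Type := ℤˣ

/-- A hypothesis (classifier) on the domain `X`. -/
abbrev Hyp (X : Type*) : Type _ := X → Label

/-- A learner maps finite training sequences to hypotheses. -/
abbrev Learner (X : Type*) : Type _ := List (X × Label) → Hyp X

/-- `H` shatters the finite set `F`: every labelling of `F` is realized by a member of `H`. -/
def Shatters {X : Type*} (H : Set (Hyp X)) (F : Finset X) : Prop :=
  ∀ g : Hyp X, ∃ h ∈ H, ∀ x ∈ F, h x = g x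

/-- `H` has (finite) VC dimension `d`: the largest size of a shattered set is `d`. -/
def HasVCDim {X : Type*} (H : Set (Hyp X)) (d : ℕ) : Prop :=
  IsGreatest {n : ℕ | ∃ F : Finset X, F.card = n ∧ Shatters H F} d

/-- The true error `P_{(x,y) ∼ D}[h x ≠ y]`. -/
def trueError {X : Type*} [MeasurableSpace X] (D : Measure (X × Label)) (h : Hyp X) : ℝ :=
  D.real {z | h z.1 ≠ z.2}

/-- The error `τ` of the best hypothesis of `H`. -/
def bestError {X : Type*} [MeasurableSpace X] (D : Measure (X × Label)) (H : Set (Hyp X)) : ℝ :=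
  sInf (trueError D '' H)

/-- The empirical error of `h` on `S`: the fraction of the entries of `S` on which `h` errs. -/
def empError {X : Type*} (S : List (X × Label)) (h : Hyp X) : ℝ :=
  (S.countP fun z => h z.1 ≠ z.2 : ℕ) / (S.length : ℝ)

/-- `A` is an empirical risk minimization learner for `H`. -/
def IsERM {X : Type*} (H : Set (Hyp X)) (A : Learner X) : Prop :=
  ∀ S, A S ∈ H ∧ ∀ h ∈ H, empError S (A S) ≤ empError S h

/-- Measurability of a learner: on training sequences of each length `n`, the prediction
`A(S)(x)` is jointly measurable in `(S, x)`. -/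
def IsMeasurableLearner {X : Type*} [MeasurableSpace X] (A : Learner X) : Prop :=
  ∀ n : ℕ, Measurable fun p : (Fin n → X × Label) × X => A (List.ofFn p.1) p.2

/-- The `i`-th (`0 ≤ i < 27`) of the 27 consecutive blocks, each of length `3 ^ (k - 3)`,
of a sequence of length `3 ^ k`. -/
def block {Z : Type*} (k : ℕ) (S : List Z) (i : ℕ) : List Z :=
  (S.drop (i * 3 ^ (k - 3))).take (3 ^ (k - 3))

/-- The recursive 27-way splitting algorithm on input `(S; T)` with `|S| = 3 ^ k`. If `6 ≤ k`, the
block `S_i` is cut into its first `3 ^ (k - 6)` entries, on which the algorithm recurses, and the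
remaining ones, which are prepended to `T`; if `k < 6`, the only output is `S ⊔ T`. -/
def split {Z : Type*} (k : ℕ) (S T : List Z) : List (List Z) :=
  if 6 ≤ k then
    (List.range 27).flatMap fun i =>
      split (k - 6) ((block k S i).take (3 ^ (k - 6))) ((block k S i).drop (3 ^ (k - 6)) ++ T)
  else [S ++ T]
termination_by k

/-- The splitting algorithm produces `27 ^ ⌊k / 6⌋` training sequences. -/
theorem length_split {Z : Type*} (k : ℕ) (S T : List Z) :
    (split k S T).length = 27 ^ (k / 6) := by
  induction k using Nat.strong_induction_on generalizing S T with
  | _ k ih =>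
    rw [split]
    split_ifs with hk
    · have hlt : k - 6 < k := by omega
      have hd : k / 6 = (k - 6) / 6 + 1 := by omega
      simp only [List.length_flatMap, ih _ hlt, List.map_const', List.sum_replicate,
        List.length_range, smul_eq_mul]
      rw [hd, pow_succ, mul_comm]
    · have : k / 6 = 0 := by omega
      simp [this]

/-- The multiset of hypotheses `A(S; T)`, listed as a family: run `A` on every training sequence
produced by the splitting algorithm on `(S; T)`. -/
def allVoters {X : Type*} (A : Learner X) (k : ℕ) (S T : List (X × Label)) :
    Fin (27 ^ (k / 6)) → Hyp X :=
  fun j => A ((split k S T).get (j.cast (length_split k S T).symm))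

/-- The law of `t` independent draws, uniform with replacement, from the `27 ^ ⌊k / 6⌋` indices. -/
def drawLaw (k t : ℕ) : Measure (Fin t → Fin (27 ^ (k / 6))) :=
  Measure.pi fun _ => uniformOn Set.univ

/-- The `t` hypotheses drawn from `A(S; ∅)` when the draws are `r`. -/
def drawnVoters {X : Type*} (A : Learner X) (k : ℕ) {t : ℕ} (S : List (X × Label))
    (r : Fin t → Fin (27 ^ (k / 6))) : Fin t → Hyp X :=
  fun i => allVoters A k S [] (r i)

/-- The fraction of the voters `V` that err on the example `z = (x, y)`. -/
def avgErr {X : Type*} {t : ℕ} (V : Fin t → Hyp X) (z : X × Label) : ℝ :=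
  (∑ i, if V i z.1 ≠ z.2 then 1 else 0) / (t : ℝ)

/-- The probability over `z ∼ D` that at least an `α`-fraction of the voters errs on `z`. -/
def voteError {X : Type*} [MeasurableSpace X] (D : Measure (X × Label)) (α : ℝ) {t : ℕ}
    (V : Fin t → Hyp X) : ℝ :=
  D.real {z | α ≤ avgErr V z}

end AgnosticVoting

end

namespace AgnosticVoting

open scoped ENNReal NNReal

/-! Call an example bad for `(S; T)` if at least a fraction 10/243 of all voters err on it. The core
is `pi_badRegion_le`: for fixed `h ∈ H`, with probability 1 - δ over S, the bad region has mass at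
most 3^18 (e + d + ln(e/δ)) / 3^k, where the count e is the number of errors of `h` on S ⊔ T. No
logarithm of m/d appears. The proof is by induction along the splitting.

On a bad example the wrong votes amount to at least 10/9 of the votes of one block. The block i with
most wrong votes is therefore bad on its own, and as it supplies at most one block's worth, the
other blocks supply at least 1/9 (`exists_block_of_votes`). Hence the mass of the bad region is at
most a constant times the largest D(R_i ∩ {v errs}), with R_i the bad region of block i and v a
voter of a block j ≠ i (`measureReal_badRegion_le`).

Fix everything but the tail of block j, of length n. Then R_i is fixed and v is a member of H chosen
from a fresh sample. Symmetrization, with Sauer–Shelah applied only to sample points inside R_i,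
bounds n D(R_i ∩ {v errs}) by a constant times (errors of v on the tail) + d ln(1/x) + n x D(R_i) +
ln(1/δ) for any 0 < x ≤ 1 (`pi_exists_excess_le`). By induction n D(R_i) is already O(e + d +
ln(1/δ) + 1), so a constant x suffices and d ln(1/x) costs only O(d). Since v is an ERM on a
sequence that contains the tail and is contained in S ⊔ T, it errs at most e times on the tail.

Finally a Chernoff bound controls e for a near-optimal `h`. Off the bad region, a Chernoff bound
over the draws, with Fubini and Markov, passes from all voters to the drawn ones and from 10/243 to
11/243. -/

instance : MeasurableSingletonClass Label where
  measurableSet_singleton u := by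
    refine ⟨{(u : ℤ)}, measurableSet_singleton _, ?_⟩
    ext v
    simp [Units.ext_iff]

/-! ### Resampling part of the coordinates of a product measure -/

section Override

variable {ι κ Z : Type*}

open Classical in
/-- Replace the coordinates of `s` in the range of `f` by those of `u`. -/
noncomputable def override (f : ι ↪ κ) (s : κ → Z) (u : ι → Z) : κ → Z :=
  fun i => if h : ∃ a, f a = i then u h.choose else s i

theorem override_apply (f : ι ↪ κ) (s : κ → Z) (u : ι → Z) (a : ι) :
    override f s u (f a) = u a := by
  have h : ∃ b, f b = f a := ⟨a, rfl⟩
  rw [override, dif_pos h, f.injective h.choose_spec]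

theorem override_of_notMem (f : ι ↪ κ) (s : κ → Z) (u : ι → Z) {i : κ} (h : ∀ a, f a ≠ i) :
    override f s u i = s i :=
  dif_neg (by simpa using h)

end Override

section Product

variable {ι κ Z : Type*} [Fintype ι] [Fintype κ] [MeasurableSpace Z]

/-- The integral of a product of functions of the coordinates under a power of `D`. -/
theorem lintegral_pi_prod (D : Measure Z) [IsProbabilityMeasure D] {f : Z → ℝ≥0∞}
    (hf : Measurable f) :
    ∫⁻ s, ∏ i, f (s i) ∂(Measure.pi fun _ : ι => D) = (∫⁻ z, f z ∂D) ^ Fintype.card ι := by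
  have hind : iIndepFun (fun (i : ι) (s : ι → Z) => f (s i)) (Measure.pi fun _ : ι => D) :=
    iIndepFun_pi (X := fun _ : ι => f) fun _ => hf.aemeasurable
  rw [lintegral_prod_eq_prod_lintegral_of_indepFun Finset.univ _ hind
    fun i => hf.comp (measurable_pi_apply i)]
  have (i : ι) : ∫⁻ s, f (s i) ∂(Measure.pi fun _ : ι => D) = ∫⁻ z, f z ∂D :=
    (measurePreserving_eval (fun _ : ι => D) i).lintegral_comp hf
  simp [this]

theorem measurePreserving_override (D : Measure Z) [IsProbabilityMeasure D] (f : ι ↪ κ) :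
    MeasurePreserving (fun p : (κ → Z) × (ι → Z) => override f p.1 p.2)
      ((Measure.pi fun _ => D).prod (Measure.pi fun _ => D)) (Measure.pi fun _ => D) := by
  classical
  have hm : Measurable fun p : (κ → Z) × (ι → Z) => override f p.1 p.2 := by
    refine measurable_pi_iff.2 fun i => ?_
    by_cases h : ∃ a, f a = i
    · simp only [override, dif_pos h]; fun_prop
    · simp only [override, dif_neg h]; fun_prop
  refine ⟨hm, (Measure.pi_eq fun B hB => ?_).symm⟩
  rw [Measure.map_apply hm (MeasurableSet.univ_pi hB)]
  -- The preimage of a box is again a box: the coordinates of `s` in the range of `f` become free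
  -- and `u` takes over their constraints.
  have hpre : (fun p : (κ → Z) × (ι → Z) => override f p.1 p.2) ⁻¹' Set.univ.pi B =
      (Set.univ.pi fun i => if ∃ a, f a = i then Set.univ else B i) ×ˢ
        (Set.univ.pi fun a => B (f a)) := by
    ext ⟨s, u⟩
    simp only [Set.mem_preimage, Set.mem_pi, Set.mem_univ, true_imp_iff, Set.mem_prod]
    constructor
    · intro h
      refine ⟨fun i => ?_, fun a => override_apply f s u a ▸ h (f a)⟩
      split_ifs with hi
      · trivial
      · exact override_of_notMem f s u (by simpa using hi) ▸ h i
    · rintro ⟨h₁, h₂⟩ i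
      by_cases hi : ∃ a, f a = i
      · obtain ⟨a, rfl⟩ := hi
        rw [override_apply]; exact h₂ a
      · rw [override_of_notMem f s u (by simpa using hi)]
        simpa [hi] using h₁ i
  rw [hpre, Measure.prod_prod, Measure.pi_pi, Measure.pi_pi]
  have h₁ : ∏ a, D (B (f a)) = ∏ i, if ∃ a, f a = i then D (B i) else 1 := by
    rw [← Finset.prod_filter, ← Finset.prod_map Finset.univ f fun i => D (B i)]
    refine Finset.prod_congr ?_ fun _ _ => rfl
    ext i; simp
  rw [h₁, ← Finset.prod_mul_distrib]
  refine Finset.prod_congr rfl fun i _ => ?_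
  split_ifs <;> simp

/-- If resampling the coordinates in the range of `f` always puts mass at most `ε` on `E`, then
`E` has mass at most `ε`. -/
theorem pi_le_of_override_le (D : Measure Z) [IsProbabilityMeasure D] (f : ι ↪ κ)
    {E : Set (κ → Z)} (hE : MeasurableSet E) {ε : ℝ≥0∞}
    (h : ∀ s, (Measure.pi fun _ : ι => D) {u | override f s u ∈ E} ≤ ε) :
    (Measure.pi fun _ : κ => D) E ≤ ε := by
  have hp := measurePreserving_override D f
  rw [← hp.measure_preimage hE.nullMeasurableSet, Measure.prod_apply (hp.measurable hE)]
  calc _ ≤ ∫⁻ _, ε ∂(Measure.pi fun _ : κ => D) := lintegral_mono h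
    _ = ε := by simp

end Product

/-! ### Sauer–Shelah with a free parameter -/

section Sauer

variable {X : Type*}

/-- A form of the Sauer–Shelah lemma: a class of VC dimension `d` is represented on a finite set
`F` by at most `x⁻ᵈ (1 + x) ^ |F|` hypotheses. -/
theorem exists_trace_cover {H : Set (Hyp X)} {d : ℕ} (hd : HasVCDim H d) (F : Finset X)
    {x : ℝ≥0} (hx : x ≤ 1) :
    ∃ G : Finset (Hyp X), x ^ d * G.card ≤ (1 + x) ^ F.card ∧
      ∀ h ∈ H, ∃ g ∈ G, ∀ a ∈ F, g a = h a := by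
  classical
  let 𝒜 : Finset (Finset X) := F.powerset.filter fun t => ∃ h ∈ H, t = F.filter fun a => h a = 1
  have hone (u v : Label) : (u = 1 ↔ v = 1) → u = v := by
    rcases Int.units_eq_one_or u with rfl | rfl <;>
      rcases Int.units_eq_one_or v with rfl | rfl <;> simp
  have hsh : ∀ s ∈ 𝒜.shatterer, s ⊆ F ∧ s.card ≤ d := by
    intro s hs
    have hs' := Finset.mem_shatterer.1 hs
    have hsF : s ⊆ F := by
      obtain ⟨u, hu, hsu⟩ := hs' (Finset.Subset.refl s)
      have hu' := Finset.mem_powerset.1 (Finset.mem_filter.1 hu).1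
      exact (Finset.inter_eq_left.1 hsu).trans hu'
    refine ⟨hsF, hd.2 ⟨s, rfl, fun g => ?_⟩⟩
    obtain ⟨u, hu, hsu⟩ := hs' (Finset.filter_subset (fun a => g a = 1) s)
    obtain ⟨-, h, hh, rfl⟩ := Finset.mem_filter.1 hu
    refine ⟨h, hh, fun a ha => hone _ _ ?_⟩
    have := Finset.ext_iff.1 hsu a
    simpa [ha, hsF ha] using this
  -- One representative per trace on `F`; it need not belong to `H`.
  refine ⟨𝒜.image fun t a => if a ∈ t then 1 else -1, ?_, ?_⟩
  -- Pajor: a family has at most as many members as it shatters sets. These have size at most `d`,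
  -- so `x ^ d ≤ x ^ s.card`, and the binomial theorem sums over all subsets of `F`.
  · calc x ^ d * ((𝒜.image fun t (a : X) => if a ∈ t then (1 : Label) else -1).card : ℝ≥0)
        ≤ x ^ d * (𝒜.shatterer.card : ℝ≥0) := by
          gcongr
          exact Finset.card_image_le.trans 𝒜.card_le_card_shatterer
      _ = ∑ s ∈ 𝒜.shatterer, x ^ d := by rw [Finset.sum_const, nsmul_eq_mul, mul_comm]
      _ ≤ ∑ s ∈ 𝒜.shatterer, x ^ s.card * 1 ^ (F.card - s.card) :=
          Finset.sum_le_sum fun s hs => by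
            rw [one_pow, mul_one]; exact pow_le_pow_of_le_one zero_le hx (hsh s hs).2
      _ ≤ ∑ s ∈ F.powerset, x ^ s.card * 1 ^ (F.card - s.card) :=
          Finset.sum_le_sum_of_subset fun s hs => Finset.mem_powerset.2 (hsh s hs).1
      _ = (1 + x) ^ F.card := by rw [Finset.sum_pow_mul_eq_add_pow, add_comm]
  · intro h hh
    refine ⟨_, Finset.mem_image_of_mem _ (Finset.mem_filter.2
      ⟨Finset.mem_powerset.2 (Finset.filter_subset (fun a => h a = 1) F), h, hh, rfl⟩), ?_⟩
    intro a ha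
    refine hone _ _ ?_
    by_cases h1 : h a = 1 <;> simp [ha, h1]

end Sauer

/-! ### Combinatorics of the splitting algorithm -/

section Split

variable {Z W : Type*}

/-- The algorithm looks only at positions, never at values; measurability of the voters rests on
this. -/
theorem split_map (f : Z → W) (k : ℕ) (S T : List Z) :
    split k (S.map f) (T.map f) = (split k S T).map (List.map f) := by
  induction k using Nat.strong_induction_on generalizing S T with
  | _ k ih =>
    rw [split, split]
    split_ifs with hk
    · rw [List.map_flatMap]
      refine List.flatMap_congr fun i _ => ?_
      rw [← ih _ (by omega)]
      simp [block, List.map_take, List.map_drop]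
    · simp

theorem countP_take_add_drop (p : Z → Bool) (n : ℕ) (L : List Z) :
    (L.take n).countP p + (L.drop n).countP p = L.countP p := by
  rw [← List.countP_append, List.take_append_drop]

theorem countP_block_le (p : Z → Bool) (k : ℕ) (S : List Z) (i : ℕ) :
    (block k S i).countP p ≤ S.countP p :=
  ((List.take_sublist _ _).trans (List.drop_sublist _ _)).countP_le

/-- Each training sequence contains all of `T` and uses entries of `S ⊔ T` without repetition. Both
halves feed the ERM comparison. -/
theorem countP_le_of_mem_split (p : Z → Bool) (k : ℕ) (S T : List Z) {L : List Z}
    (hL : L ∈ split k S T) :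
    T.countP p ≤ L.countP p ∧ L.countP p ≤ S.countP p + T.countP p := by
  induction k using Nat.strong_induction_on generalizing S T with
  | _ k ih =>
    rw [split] at hL
    split_ifs at hL with hk
    · obtain ⟨i, -, hi⟩ := List.mem_flatMap.1 hL
      have h := ih _ (by omega) _ _ hi
      have h₁ := countP_take_add_drop p (3 ^ (k - 6)) (block k S i)
      have h₂ := countP_block_le p k S i
      rw [List.countP_append] at h
      omega
    · rw [List.mem_singleton.1 hL, List.countP_append]
      omega

theorem countP_split_of_le (p : List Z → Bool) {k : ℕ} (hk : 6 ≤ k) (S T : List Z) :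
    (split k S T).countP p = ∑ i ∈ Finset.range 27,
      (split (k - 6) ((block k S i).take (3 ^ (k - 6)))
        ((block k S i).drop (3 ^ (k - 6)) ++ T)).countP p := by
  rw [split, if_pos hk, List.countP_flatMap]
  rfl

theorem IsERM.countP_le {X : Type*} {H : Set (Hyp X)} {A : Learner X} (hA : IsERM H A)
    (S : List (X × Label)) {h : Hyp X} (hh : h ∈ H) :
    (S.countP fun z => A S z.1 ≠ z.2) ≤ S.countP fun z => h z.1 ≠ z.2 := by
  rcases S.eq_nil_or_concat with rfl | ⟨_, _, hS⟩
  · simp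
  have h := (hA S).2 h hh
  have hpos : (0 : ℝ) < S.length := by simp [hS]; positivity
  rw [empError, empError, div_le_div_iff_of_pos_right hpos] at h
  exact_mod_cast h

end Split

/-! ### Symmetrization by exponential weights inside a region -/

section Symmetrization

variable {X : Type*}

/-- The examples on which `h` errs. -/
def errSet (h : Hyp X) : Set (X × Label) := {z | h z.1 ≠ z.2}

/-- The weight `1 + c` on `B` and `1` off `B`. -/
noncomputable def upWeight {Z : Type*} (c : ℝ≥0) (B : Set Z) (z : Z) : ℝ≥0∞ :=
  1 + c * B.indicator 1 z

open Classical in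
/-- The weight `4 / 9` on `B` and `1` off `B`. -/
noncomputable def downWeight {Z : Type*} (B : Set Z) (z : Z) : ℝ≥0∞ :=
  if z ∈ B then ((4 / 9 : ℝ≥0) : ℝ≥0∞) else 1

theorem upWeight_congr {Z : Type*} {c : ℝ≥0} {B B' : Set Z} {z : Z} (h : z ∈ B ↔ z ∈ B') :
    upWeight c B z = upWeight c B' z := by
  by_cases hz : z ∈ B
  · simp [upWeight, hz, h.1 hz]
  · simp [upWeight, hz, mt h.2 hz]

theorem downWeight_congr {Z : Type*} {B B' : Set Z} {z : Z} (h : z ∈ B ↔ z ∈ B') :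
    downWeight B z = downWeight B' z := by
  by_cases hz : z ∈ B
  · simp [downWeight, hz, h.1 hz]
  · simp [downWeight, hz, mt h.2 hz]

theorem lintegral_upWeight {Z : Type*} [MeasurableSpace Z] (D : Measure Z)
    [IsProbabilityMeasure D] (c : ℝ≥0) {B : Set Z} (hB : MeasurableSet B) :
    ∫⁻ z, upWeight c B z ∂D = 1 + c * D B := by
  unfold upWeight
  rw [lintegral_add_left measurable_const, lintegral_const_mul _
    (measurable_one.indicator hB), lintegral_indicator_one hB]
  simp

theorem measurable_upWeight {Z : Type*} [MeasurableSpace Z] (c : ℝ≥0) {B : Set Z}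
    (hB : MeasurableSet B) : Measurable (upWeight c B) :=
  ((measurable_one.indicator hB).const_mul _).const_add 1

/-- The sum is 4/3, 35/18 or 2 according as both, one or none of the points lie in `B`; this is what
the weights 1/2 and 4/9 are chosen for. -/
theorem upWeight_mul_downWeight_add_le {Z : Type*} (B : Set Z) (a b : Z) :
    upWeight (1 / 2) B b * downWeight B a + upWeight (1 / 2) B a * downWeight B b ≤ 2 := by
  have h₁ : ((1 + 1 / 2) * (4 / 9) + (1 + 1 / 2) * (4 / 9) : ℝ≥0) ≤ 2 := by
    rw [← NNReal.coe_le_coe]; push_cast; norm_num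
  have h₂ : ((1 + 1 / 2) + 4 / 9 : ℝ≥0) ≤ 2 := by
    rw [← NNReal.coe_le_coe]; push_cast; norm_num
  have h₁' : ((1 + (1 / 2 : ℝ≥0)) * (4 / 9 : ℝ≥0) + (1 + (1 / 2 : ℝ≥0)) * (4 / 9 : ℝ≥0) : ℝ≥0∞)
      ≤ 2 := by exact_mod_cast h₁
  have h₂' : ((1 + (1 / 2 : ℝ≥0)) + (4 / 9 : ℝ≥0) : ℝ≥0∞) ≤ 2 := by exact_mod_cast h₂
  by_cases ha : a ∈ B <;> by_cases hb : b ∈ B <;>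
    simp only [upWeight, downWeight, ha, hb, if_true, if_false, Set.indicator_of_mem,
      Set.indicator_of_notMem, not_false_eq_true, Pi.one_apply, mul_one, mul_zero, add_zero,
      one_mul]
  · exact h₁'
  · rwa [add_comm]
  · exact h₂'
  · exact one_add_one_eq_two.le

/-- Coinciding points only shrink the set, so its size is at most the number of sample entries in
`R`. -/
theorem one_add_pow_card_le_prod_upWeight [DecidableEq X] {n : ℕ} (x : ℝ≥0)
    (R : Set (X × Label)) [DecidablePred (· ∈ R)] (w : Fin n → (X × Label) × (X × Label)) :
    (1 + (x : ℝ≥0∞)) ^ (((Finset.univ.filter fun i => (w i).1 ∈ R).image fun i => (w i).1.1) ∪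
      ((Finset.univ.filter fun i => (w i).2 ∈ R).image fun i => (w i).2.1)).card ≤
      ∏ i, upWeight x R (w i).1 * upWeight x R (w i).2 := by
  have hprod (g : Fin n → X × Label) : ∏ i, upWeight x R (g i) =
      (1 + (x : ℝ≥0∞)) ^ (Finset.univ.filter fun i => g i ∈ R).card := by
    have (i : Fin n) : upWeight x R (g i) = if g i ∈ R then 1 + (x : ℝ≥0∞) else 1 := by
      by_cases h : g i ∈ R <;> simp [upWeight, h]
    simp_rw [this]
    rw [Finset.prod_ite]
    simp
  rw [Finset.prod_mul_distrib, hprod fun i => (w i).1, hprod fun i => (w i).2, ← pow_add]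
  refine pow_le_pow_right₀ (by simp) ((Finset.card_union_le _ _).trans ?_)
  exact add_le_add Finset.card_image_le Finset.card_image_le

/-- The weight of the double sample `w` for the hypothesis `h`: large if `h` errs within `R` much
more often on the second components than on the first ones. -/
noncomputable def pairWeight {n : ℕ} (R : Set (X × Label)) (h : Hyp X)
    (w : Fin n → (X × Label) × (X × Label)) : ℝ≥0∞ :=
  ∏ i, upWeight (1 / 2) (R ∩ errSet h) (w i).2 * downWeight (R ∩ errSet h) (w i).1

/-- Exchange the components of the pairs `w i` with `σ i = true`. -/
def swapPairs {n : ℕ} {Z : Type*} (σ : Fin n → Bool) (w : Fin n → Z × Z) : Fin n → Z × Z :=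
  fun i => if σ i then (w i).swap else w i

/-- For fixed `h` the weight factorizes over the pairs, so the sum over all swaps is a product of
two-term sums. -/
theorem sum_pairWeight_swapPairs_le {n : ℕ} (R : Set (X × Label)) (h : Hyp X)
    (w : Fin n → (X × Label) × (X × Label)) :
    ∑ σ : Fin n → Bool, pairWeight R h (swapPairs σ w) ≤ 2 ^ n := by
  set B := R ∩ errSet h
  let f : Fin n → Bool → ℝ≥0∞ := fun i b =>
    if b then upWeight (1 / 2) B (w i).1 * downWeight B (w i).2
    else upWeight (1 / 2) B (w i).2 * downWeight B (w i).1
  have h₁ (σ : Fin n → Bool) : pairWeight R h (swapPairs σ w) = ∏ i, f i (σ i) := by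
    refine Finset.prod_congr rfl fun i _ => ?_
    by_cases hσ : σ i <;> simp [swapPairs, f, hσ, B]
  simp_rw [h₁]
  rw [← Fintype.prod_sum]
  calc ∏ i, ∑ b, f i b ≤ ∏ _i : Fin n, 2 := Finset.prod_le_prod' fun i _ => by
        rw [Fintype.sum_bool, add_comm]
        exact upWeight_mul_downWeight_add_le B _ _
    _ = 2 ^ n := by simp

/-- The chosen hypothesis varies with the swap, but its weight depends only on its trace on the
sample points in `R`, a set that no swap changes. Summing over a cover of the traces removes the
dependence. Only points in `R` enter the cover, which is why the final bound involves `D R`. -/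
theorem sum_iSup_pairWeight_le {H : Set (Hyp X)} {d : ℕ} (hd : HasVCDim H d) {n : ℕ}
    (R : Set (X × Label)) {x : ℝ≥0} (hx : x ≤ 1) {Q : Type*}
    (V : Q → (Fin n → X × Label) → Hyp X) (hVH : ∀ q s, V q s ∈ H)
    (w : Fin n → (X × Label) × (X × Label)) :
    (x : ℝ≥0∞) ^ d * ∑ σ : Fin n → Bool, ⨆ q,
        pairWeight R (V q fun i => (swapPairs σ w i).1) (swapPairs σ w) ≤
      2 ^ n * ∏ i, upWeight x R (w i).1 * upWeight x R (w i).2 := by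
  classical
  set F := ((Finset.univ.filter fun i => (w i).1 ∈ R).image fun i => (w i).1.1) ∪
      ((Finset.univ.filter fun i => (w i).2 ∈ R).image fun i => (w i).2.1)
  obtain ⟨G, hG, hcov⟩ := exists_trace_cover hd F hx
  have hF₁ (i : Fin n) (hi : (w i).1 ∈ R) : (w i).1.1 ∈ F :=
    Finset.mem_union_left _ (Finset.mem_image.2 ⟨i, by simpa using hi, rfl⟩)
  have hF₂ (i : Fin n) (hi : (w i).2 ∈ R) : (w i).2.1 ∈ F :=
    Finset.mem_union_right _ (Finset.mem_image.2 ⟨i, by simpa using hi, rfl⟩)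
  have key (σ : Fin n → Bool) (h : Hyp X) (hh : h ∈ H) :
      pairWeight R h (swapPairs σ w) ≤ ∑ g ∈ G, pairWeight R g (swapPairs σ w) := by
    obtain ⟨g, hg, hgh⟩ := hcov h hh
    refine le_of_eq_of_le ?_ (Finset.single_le_sum (fun _ _ => zero_le) hg)
    have h₀ (z : X × Label) (hz : z ∈ R → z.1 ∈ F) : z ∈ R ∩ errSet h ↔ z ∈ R ∩ errSet g := by
      by_cases hR : z ∈ R
      · simp [errSet, hR, hgh _ (hz hR)]
      · simp [hR]
    refine Finset.prod_congr rfl fun i _ => ?_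
    rw [upWeight_congr (h₀ _ _), downWeight_congr (h₀ _ _)]
    · by_cases hσ : σ i <;> simp only [swapPairs, hσ] <;> [exact hF₂ i; exact hF₁ i]
    · by_cases hσ : σ i <;> simp only [swapPairs, hσ] <;> [exact hF₁ i; exact hF₂ i]
  calc _ ≤ (x : ℝ≥0∞) ^ d * ∑ σ : Fin n → Bool, ∑ g ∈ G, pairWeight R g (swapPairs σ w) := by
        gcongr with σ
        exact iSup_le fun q => key σ _ (hVH _ _)
    _ = (x : ℝ≥0∞) ^ d * ∑ g ∈ G, ∑ σ : Fin n → Bool, pairWeight R g (swapPairs σ w) := by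
        rw [Finset.sum_comm]
    _ ≤ (x : ℝ≥0∞) ^ d * ∑ g ∈ G, 2 ^ n := by
        gcongr
        exact sum_pairWeight_swapPairs_le R _ w
    _ = 2 ^ n * ((x : ℝ≥0∞) ^ d * G.card) := by
        rw [Finset.sum_const, nsmul_eq_mul]; ring
    _ ≤ 2 ^ n * (1 + (x : ℝ≥0∞)) ^ F.card := by
        gcongr
        exact_mod_cast hG
    _ ≤ _ := by
        gcongr
        exact one_add_pow_card_le_prod_upWeight x R w

variable [MeasurableSpace X]

theorem measurePreserving_swapPairs {n : ℕ} {Z : Type*} [MeasurableSpace Z] (D : Measure Z)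
    [IsProbabilityMeasure D] (σ : Fin n → Bool) :
    MeasurePreserving (swapPairs σ : (Fin n → Z × Z) → Fin n → Z × Z)
      (Measure.pi fun _ => D.prod D) (Measure.pi fun _ => D.prod D) := by
  refine measurePreserving_pi (fun _ => D.prod D) (fun _ => D.prod D)
    (f := fun i z => if σ i then z.swap else z) fun i => ?_
  by_cases h : σ i
  · simpa [h] using Measure.measurePreserving_swap (μ := D) (ν := D)
  · simp only [h]
    exact MeasurePreserving.id (D.prod D)

theorem measurableSet_mem_errSet {Ω : Type*} [MeasurableSpace Ω] {V : Ω → Hyp X}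
    (hV : Measurable fun p : Ω × X => V p.1 p.2) {g : Ω → X × Label} (hg : Measurable g) :
    MeasurableSet {ω | g ω ∈ errSet (V ω)} := by
  have h₁ : Measurable fun ω => V ω (g ω).1 := hV.comp (measurable_id.prodMk hg.fst)
  exact (measurableSet_eq_fun h₁ hg.snd).compl

theorem measurableSet_errSet {h : Hyp X} (hh : Measurable h) : MeasurableSet (errSet h) :=
  measurableSet_mem_errSet (V := fun _ => h) (hh.comp measurable_snd) measurable_id

theorem measurable_pairWeight {Ω : Type*} [MeasurableSpace Ω] {n : ℕ} {R : Set (X × Label)}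
    (hR : MeasurableSet R) {V : Ω → Hyp X} (hV : Measurable fun p : Ω × X => V p.1 p.2)
    {w : Ω → Fin n → (X × Label) × (X × Label)} (hw : Measurable w) :
    Measurable fun ω => pairWeight R (V ω) (w ω) := by
  classical
  have hset {g : Ω → X × Label} (hg : Measurable g) :
      MeasurableSet {ω | g ω ∈ R ∩ errSet (V ω)} :=
    (hg hR).inter (measurableSet_mem_errSet hV hg)
  refine Finset.measurable_prod _ fun i _ => Measurable.mul ?_ ?_
  · have h := hset (g := fun ω => (w ω i).2) (by fun_prop)
    exact measurable_upWeight (1 / 2) h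
  · exact Measurable.ite (hset (g := fun ω => (w ω i).1) (by fun_prop)) measurable_const
      measurable_const

/-- Symmetrization: the exponential moment of the excess of the true over the empirical error
within `R`, uniformly over a measurable family of members of a VC class chosen from the sample. -/
theorem lintegral_iSup_le {H : Set (Hyp X)} {d : ℕ} (hd : HasVCDim H d) {n : ℕ}
    (D : Measure (X × Label)) [IsProbabilityMeasure D]
    {R : Set (X × Label)} (hR : MeasurableSet R) {x : ℝ≥0} (hx : x ≤ 1)
    {Q : Type*} [Countable Q] (V : Q → (Fin n → X × Label) → Hyp X) (hVH : ∀ q s, V q s ∈ H)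
    (hV : ∀ q, Measurable fun p : (Fin n → X × Label) × X => V q p.1 p.2) :
    (x : ℝ≥0∞) ^ d * ∫⁻ s, ⨆ q, (1 + (1 / 2 : ℝ≥0) * D (R ∩ errSet (V q s))) ^ n *
        ∏ i, downWeight (R ∩ errSet (V q s)) (s i) ∂(Measure.pi fun _ => D) ≤
      (1 + x * D R) ^ (2 * n) := by
  have hVs (q : Q) (s : Fin n → X × Label) : MeasurableSet (R ∩ errSet (V q s)) :=
    hR.inter (measurableSet_errSet ((hV q).comp measurable_prodMk_left))
  have h2 : (2 : ℝ≥0∞) ^ n ≠ 0 := by positivity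
  have h2' : (2 : ℝ≥0∞) ^ n ≠ ⊤ := ENNReal.pow_ne_top (by simp)
  set Φ : (Fin n → (X × Label) × (X × Label)) → ℝ≥0∞ := fun w =>
    ⨆ q, pairWeight R (V q fun i => (w i).1) w
  have hΦ : Measurable Φ := by
    refine Measurable.iSup fun q => measurable_pairWeight hR
      (V := fun w : Fin n → (X × Label) × (X × Label) => V q fun i => (w i).1) ?_ measurable_id
    exact (hV q).comp (by fun_prop :
      Measurable fun p : (Fin n → (X × Label) × (X × Label)) × X => ((fun i => (p.1 i).1), p.2))
  -- The power of `1 + p / 2` is the mean, over a ghost sample `s'`, of the product of the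
  -- up-weights; the supremum then moves inside the integral.
  have h₁ : ∫⁻ s, ⨆ q, (1 + (1 / 2 : ℝ≥0) * D (R ∩ errSet (V q s))) ^ n *
        ∏ i, downWeight (R ∩ errSet (V q s)) (s i) ∂(Measure.pi fun _ => D) ≤
      ∫⁻ w, Φ w ∂(Measure.pi fun _ => D.prod D) := by
    have hmp := measurePreserving_arrowProdEquivProdArrow (X × Label) (X × Label) (Fin n)
      (fun _ => D) (fun _ => D)
    have h₂ : ∫⁻ w, Φ w ∂(Measure.pi fun _ => D.prod D) =
        ∫⁻ s, ∫⁻ s', Φ (fun i => (s i, s' i)) ∂(Measure.pi fun _ => D)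
          ∂(Measure.pi fun _ => D) := by
      have hmeas : Measurable fun p : (Fin n → X × Label) × (Fin n → X × Label) =>
          Φ (fun i => (p.1 i, p.2 i)) := hΦ.comp (by fun_prop)
      rw [← lintegral_prod _ hmeas.aemeasurable, ← hmp.lintegral_comp hmeas]
      rfl
    rw [h₂]
    refine lintegral_mono fun s => iSup_le fun q => ?_
    calc _ = ∫⁻ s', pairWeight R (V q s) (fun i => (s i, s' i)) ∂(Measure.pi fun _ => D) := by
          simp only [pairWeight, Finset.prod_mul_distrib]
          have hu := measurable_upWeight (1 / 2) (hVs q s)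
          rw [lintegral_mul_const _ (by fun_prop),
            lintegral_pi_prod D (measurable_upWeight _ (hVs q s)),
            lintegral_upWeight D _ (hVs q s), Fintype.card_fin]
      _ ≤ _ := lintegral_mono fun s' =>
          le_iSup (fun q => pairWeight R (V q s) fun i => (s i, s' i)) q
  have hΦσ (σ : Fin n → Bool) : Measurable fun w => Φ (swapPairs σ w) :=
    hΦ.comp (measurePreserving_swapPairs D σ).measurable
  -- The two components of each pair are exchangeable, so `Φ` may be averaged over all swaps.
  have h₃ : (2 : ℝ≥0∞) ^ n * ∫⁻ w, Φ w ∂(Measure.pi fun _ => D.prod D) =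
      ∫⁻ w, ∑ σ : Fin n → Bool, Φ (swapPairs σ w) ∂(Measure.pi fun _ => D.prod D) := by
    rw [lintegral_finsetSum _ fun σ _ => hΦσ σ]
    simp_rw [(measurePreserving_swapPairs D _).lintegral_comp hΦ]
    simp
  have h₄ : ∫⁻ w, ∏ i, upWeight x R (w i).1 * upWeight x R (w i).2
      ∂(Measure.pi fun _ : Fin n => D.prod D) = (1 + x * D R) ^ (2 * n) := by
    have hu := measurable_upWeight x hR
    rw [lintegral_pi_prod (D.prod D)
      (f := fun z : (X × Label) × (X × Label) => upWeight x R z.1 * upWeight x R z.2)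
      (by fun_prop), lintegral_prod_mul hu.aemeasurable hu.aemeasurable,
      lintegral_upWeight D _ hR, ← sq, Fintype.card_fin, pow_mul]
  refine (mul_le_mul_right h₁ _).trans ?_
  rw [← ENNReal.mul_le_mul_iff_right h2 h2', mul_left_comm, h₃,
    ← lintegral_const_mul _ (Finset.measurable_fun_sum _ fun σ _ => hΦσ σ), ← h₄,
    ← lintegral_const_mul' _ _ h2']
  exact lintegral_mono fun w => sum_iSup_pairWeight_le hd R hx V hVH w

end Symmetrization

/-! ### The relative deviation bound -/

section UniformBound

/-- By `log y ≥ 1 - 1 / y` it suffices that `p / 3 ≤ p / (2 + p)`, which holds for `0 ≤ p ≤ 1`. -/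
theorem exp_div_three_le {p : ℝ} (h0 : 0 ≤ p) (h1 : p ≤ 1) : Real.exp (p / 3) ≤ 1 + 1 / 2 * p := by
  have hpos : 0 < 1 + 1 / 2 * p := by positivity
  rw [← Real.le_log_iff_exp_le hpos]
  refine le_trans ?_ (Real.one_sub_inv_le_log_of_pos hpos)
  rw [le_sub_iff_add_le, ← le_sub_iff_add_le', inv_eq_one_div, div_le_iff₀ hpos]
  nlinarith

theorem exp_neg_one_le : Real.exp (-1) ≤ 4 / 9 := by
  rw [Real.exp_neg, inv_le_comm₀ (Real.exp_pos 1) (by norm_num)]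
  have := Real.exp_one_gt_d9
  norm_num at this ⊢
  linarith

theorem countP_ofFn {Z : Type*} {n : ℕ} (s : Fin n → Z) (p : Z → Prop) [DecidablePred p] :
    (List.ofFn s).countP (fun z => p z) = ∑ i, if p (s i) then 1 else 0 := by
  induction n with
  | zero => simp
  | succ n ih =>
    rw [List.ofFn_succ, List.countP_cons, ih, Fin.sum_univ_succ, add_comm]
    simp

variable {X : Type*} [MeasurableSpace X]

theorem measurableSet_setOf_errSet {Ω : Type*} [MeasurableSpace Ω] {V : Ω → Hyp X}
    (hV : Measurable fun p : Ω × X => V p.1 p.2) :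
    MeasurableSet {p : Ω × (X × Label) | p.2 ∈ errSet (V p.1)} :=
  measurableSet_mem_errSet (V := fun p : Ω × (X × Label) => V p.1)
    (hV.comp (by fun_prop : Measurable fun q : (Ω × (X × Label)) × X => (q.1.1, q.2)))
    measurable_snd

/-- Each factor `1 + p / 2` is at least `exp (p / 3)` and each down-weight pays at least `exp (-1)`
per error. Errors outside `R` are counted as well, which only lowers the left side. -/
theorem exp_le_weight {n : ℕ} (D : Measure (X × Label)) [IsProbabilityMeasure D]
    (R : Set (X × Label)) (h : Hyp X) (s : Fin n → X × Label) :
    ENNReal.ofReal (Real.exp (n * D.real (R ∩ errSet h) / 3 -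
        ((List.ofFn s).countP fun z => h z.1 ≠ z.2 : ℕ))) ≤
      (1 + (1 / 2 : ℝ≥0) * D (R ∩ errSet h)) ^ n * ∏ i, downWeight (R ∩ errSet h) (s i) := by
  classical
  set B := R ∩ errSet h
  have h₁ : ENNReal.ofReal (Real.exp (D.real B / 3)) ≤ 1 + (1 / 2 : ℝ≥0) * D B := by
    refine (ENNReal.ofReal_le_ofReal (exp_div_three_le measureReal_nonneg
      measureReal_le_one)).trans ?_
    rw [ENNReal.ofReal_add zero_le_one (by positivity), ENNReal.ofReal_mul (by norm_num),
      ofReal_measureReal, ENNReal.ofReal_one]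
    gcongr
    rw [ENNReal.ofReal, Real.toNNReal_div zero_le_one]
    simp
  have h₂ (i : Fin n) : ENNReal.ofReal (Real.exp (-(if h (s i).1 ≠ (s i).2 then 1 else 0))) ≤
      downWeight B (s i) := by
    by_cases hi : s i ∈ B
    · have hi' : h (s i).1 ≠ (s i).2 := hi.2
      rw [if_pos hi', downWeight, if_pos hi]
      refine (ENNReal.ofReal_le_ofReal exp_neg_one_le).trans ?_
      rw [ENNReal.ofReal, Real.toNNReal_div (by norm_num)]
      simp
    · rw [downWeight, if_neg hi, ← ENNReal.ofReal_one]
      refine ENNReal.ofReal_le_ofReal ?_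
      rw [Real.exp_le_one_iff]
      split_ifs <;> norm_num
  calc _ = ENNReal.ofReal (Real.exp (D.real B / 3)) ^ n *
        ∏ i, ENNReal.ofReal (Real.exp (-(if h (s i).1 ≠ (s i).2 then 1 else 0))) := by
        rw [← ENNReal.ofReal_pow (Real.exp_pos _).le, ← ENNReal.ofReal_prod_of_nonneg
          fun _ _ => (Real.exp_pos _).le, ← ENNReal.ofReal_mul (by positivity), ← Real.exp_nat_mul,
          ← Real.exp_sum, ← Real.exp_add, Finset.sum_neg_distrib, countP_ofFn s]
        push_cast
        rw [mul_div_assoc, sub_eq_add_neg]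
    _ ≤ _ := by
        gcongr with i
        exact h₂ i

/-- A relative deviation bound within the region `R`, uniform over a measurable family of members
of a VC class chosen from the sample. -/
theorem pi_exists_excess_le {H : Set (Hyp X)} {d : ℕ} (hd : HasVCDim H d) {n : ℕ}
    (D : Measure (X × Label)) [IsProbabilityMeasure D]
    {R : Set (X × Label)} (hR : MeasurableSet R) {x : ℝ} (hx0 : 0 < x) (hx : x ≤ 1)
    {Q : Type*} [Countable Q] (V : Q → (Fin n → X × Label) → Hyp X) (hVH : ∀ q s, V q s ∈ H)
    (hV : ∀ q, Measurable fun p : (Fin n → X × Label) × X => V q p.1 p.2) {δ : ℝ} (hδ : 0 < δ) :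
    (Measure.pi fun _ : Fin n => D) {s | ∃ q,
        3 * (((List.ofFn s).countP fun z => V q s z.1 ≠ z.2 : ℕ) + d * Real.log (1 / x) +
          2 * n * x * D.real R + Real.log (1 / δ)) < n * D.real (R ∩ errSet (V q s))} ≤
      ENNReal.ofReal δ := by
  classical
  set f : (Fin n → X × Label) → ℝ≥0∞ := fun s =>
    ⨆ q, (1 + (1 / 2 : ℝ≥0) * D (R ∩ errSet (V q s))) ^ n *
        ∏ i, downWeight (R ∩ errSet (V q s)) (s i) with hf
  have hfm : Measurable f := by
    refine Measurable.iSup fun q => Measurable.mul ?_ ?_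
    · have h₁ : Measurable fun s => D (R ∩ errSet (V q s)) :=
        measurable_measure_prodMk_left
          ((measurable_snd hR).inter (measurableSet_setOf_errSet (hV q)))
      exact ((h₁.const_mul _).const_add 1).pow_const n
    · refine Finset.measurable_fun_prod _ fun i _ => ?_
      exact Measurable.ite ((measurable_pi_apply i hR).inter
        (measurableSet_mem_errSet (hV q) (measurable_pi_apply i))) measurable_const
        measurable_const
  set ε : ℝ := Real.exp (d * Real.log (1 / x) + 2 * n * x * D.real R + Real.log (1 / δ)) with hε
  have hεpos : 0 < ε := Real.exp_pos _
  set E := {s | ∃ q, 3 * (((List.ofFn s).countP fun z => V q s z.1 ≠ z.2 : ℕ) +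
    d * Real.log (1 / x) + 2 * n * x * D.real R + Real.log (1 / δ)) <
      n * D.real (R ∩ errSet (V q s))} with hE
  -- A failure for a single `q` already makes the supremum at least `ε`, so Markov's inequality
  -- needs no union bound over `q`.
  have hsub : E ⊆ {s | ENNReal.ofReal ε ≤ f s} := by
    rintro s ⟨q, hq⟩
    change ENNReal.ofReal ε ≤ f s
    refine le_trans ?_ (le_iSup _ q)
    refine le_trans (ENNReal.ofReal_le_ofReal ?_) (exp_le_weight D R (V q s) s)
    rw [hε, Real.exp_le_exp]
    linarith
  have hmarkov : ENNReal.ofReal ε * (Measure.pi fun _ : Fin n => D) E ≤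
      ∫⁻ s, f s ∂(Measure.pi fun _ : Fin n => D) :=
    (mul_le_mul_right (measure_mono hsub) _).trans (mul_meas_ge_le_lintegral hfm _)
  have hexp : ENNReal.ofReal x ^ d * ∫⁻ s, f s ∂(Measure.pi fun _ : Fin n => D) ≤
      (1 + ENNReal.ofReal x * D R) ^ (2 * n) :=
    lintegral_iSup_le hd D hR (Real.toNNReal_le_one.2 hx) V hVH hV
  -- With `1 + a ≤ exp a`, the left side is at most `exp (2 * n * x * D.real R)`; `ε` is chosen so
  -- that `x ^ d * ε * δ` equals this.
  have hrhs : (1 + ENNReal.ofReal x * D R) ^ (2 * n) ≤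
      ENNReal.ofReal x ^ d * (ENNReal.ofReal ε * ENNReal.ofReal δ) := by
    rw [← ofReal_measureReal (μ := D) (s := R), ← ENNReal.ofReal_one, ← ENNReal.ofReal_mul hx0.le,
      ← ENNReal.ofReal_add zero_le_one (by positivity), ← ENNReal.ofReal_pow (by positivity),
      ← ENNReal.ofReal_pow hx0.le, ← ENNReal.ofReal_mul hεpos.le,
      ← ENNReal.ofReal_mul (by positivity)]
    refine ENNReal.ofReal_le_ofReal ?_
    have h₁ : x ^ d * (ε * δ) = Real.exp (x * D.real R) ^ (2 * n) := by
      have hxe : x ^ d = Real.exp (d * Real.log x) := by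
        rw [Real.exp_nat_mul, Real.exp_log hx0]
      rw [hxe, hε]
      nth_rw 2 [← Real.exp_log hδ]
      rw [← Real.exp_nat_mul, ← Real.exp_add, ← Real.exp_add, one_div, one_div, Real.log_inv,
        Real.log_inv]
      congr 1
      push_cast
      ring
    rw [h₁]
    gcongr
    rw [add_comm]
    exact Real.add_one_le_exp _
  have hx' : ENNReal.ofReal x ^ d ≠ 0 := pow_ne_zero _ (ENNReal.ofReal_pos.2 hx0).ne'
  have hx'' : ENNReal.ofReal x ^ d ≠ ⊤ := ENNReal.pow_ne_top ENNReal.ofReal_ne_top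
  have hfin := (mul_le_mul_right hmarkov _).trans (hexp.trans hrhs)
  rw [ENNReal.mul_le_mul_iff_right hx' hx'', ENNReal.mul_le_mul_iff_right
    (ENNReal.ofReal_pos.2 hεpos).ne' ENNReal.ofReal_ne_top] at hfin
  exact hfin

end UniformBound

/-! ### Joint measurability of voters and bad regions -/

section MeasurableVoters

variable {Ω Z : Type*} [MeasurableSpace Ω] [MeasurableSpace Z]

/-- A random list of constant length whose entries depend measurably on `ω`. -/
def MeasurableList (L : Ω → List Z) : Prop :=
  ∃ (n : ℕ) (l : Ω → Fin n → Z), Measurable l ∧ ∀ ω, L ω = List.ofFn (l ω)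

theorem MeasurableList.const (L : List Z) : MeasurableList fun _ : Ω => L :=
  ⟨L.length, fun _ => L.get, measurable_const, fun _ => (List.ofFn_get L).symm⟩

theorem MeasurableList.ofFn {n : ℕ} {l : Ω → Fin n → Z} (hl : Measurable l) :
    MeasurableList fun ω => List.ofFn (l ω) :=
  ⟨n, l, hl, fun _ => rfl⟩

theorem MeasurableList.append {L L' : Ω → List Z} (hL : MeasurableList L)
    (hL' : MeasurableList L') : MeasurableList fun ω => L ω ++ L' ω := by
  obtain ⟨n, l, hl, h⟩ := hL
  obtain ⟨n', l', hl', h'⟩ := hL'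
  refine ⟨n + n', fun ω => Fin.append (l ω) (l' ω), measurable_pi_iff.2 fun i => ?_, fun ω => ?_⟩
  · refine Fin.addCases (fun j => ?_) (fun j => ?_) i
    · simp only [Fin.append_left]; fun_prop
    · simp only [Fin.append_right]; fun_prop
  · simp only [h, h', List.ofFn_fin_append]

variable {X : Type*} [MeasurableSpace X]

/-- Run the algorithm on symbolic lists of positions, `Sum.inl` for `S` and `Sum.inr` for `T`. Voter
`j` then trains on a fixed list of positions filled in measurably, and measurability at that one
length applies. -/
theorem MeasurableList.measurable_learner {A : Learner X} (hA : IsMeasurableLearner A)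
    {S T : Ω → List (X × Label)} (hS : MeasurableList S) (hT : MeasurableList T) (k : ℕ)
    (j : Fin (27 ^ (k / 6))) :
    Measurable fun p : Ω × X => allVoters A k (S p.1) (T p.1) j p.2 := by
  obtain ⟨a, s, hs, hS⟩ := hS
  obtain ⟨b, t, ht, hT⟩ := hT
  let L : List (List (Fin a ⊕ Fin b)) := split k (List.ofFn Sum.inl) (List.ofFn Sum.inr)
  let l : List (Fin a ⊕ Fin b) := L.get (j.cast (length_split k _ _).symm)
  let f : Ω → Fin a ⊕ Fin b → X × Label := fun ω => Sum.elim (s ω) (t ω)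
  have hf : Measurable f := measurable_pi_iff.2 fun c => by
    rcases c with c | c
    · exact (measurable_pi_apply c).comp hs
    · exact (measurable_pi_apply c).comp ht
  have hsplit (ω : Ω) : split k (S ω) (T ω) = L.map (List.map (f ω)) := by
    rw [← split_map, List.map_ofFn, List.map_ofFn, hS, hT]
    rfl
  have hget (ω : Ω) : (split k (S ω) (T ω)).get (j.cast (length_split k _ _).symm) =
      List.ofFn fun i : Fin l.length => f ω (l.get i) := by
    have h₁ : (split k (S ω) (T ω)).get (j.cast (length_split k _ _).symm) = l.map (f ω) := by
      simp [l, hsplit]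
    rw [h₁]
    conv_lhs => rw [← List.ofFn_get l, List.map_ofFn]
    rfl
  have heq : (fun p : Ω × X => allVoters A k (S p.1) (T p.1) j p.2) =
      fun p : Ω × X => A (List.ofFn fun i : Fin l.length => f p.1 (l.get i)) p.2 := by
    funext p
    rw [allVoters, hget]
  rw [heq]
  exact (hA l.length).comp
    (g := fun q : (Fin l.length → X × Label) × X => A (List.ofFn q.1) q.2)
    (f := fun p : Ω × X => ((fun i => f p.1 (l.get i)), p.2)) (by fun_prop)

/-- The number of entries of `S` on which `h` errs. -/
def errCount (h : Hyp X) (S : List (X × Label)) : ℕ := S.countP fun z => h z.1 ≠ z.2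

theorem MeasurableList.measurable_errCount {S : Ω → List (X × Label)} (hS : MeasurableList S)
    {V : Ω → Hyp X} (hV : Measurable fun p : Ω × X => V p.1 p.2) :
    Measurable fun ω => errCount (V ω) (S ω) := by
  obtain ⟨n, s, hs, hS⟩ := hS
  simp only [errCount, hS]
  simp only [countP_ofFn]
  exact Finset.measurable_fun_sum _ fun i _ => Measurable.ite
    (measurableSet_mem_errSet hV ((measurable_pi_apply i).comp hs)) measurable_const
    measurable_const

theorem split_eq_ofFn {Z : Type*} (k : ℕ) (S T : List Z) :
    split k S T = List.ofFn fun j : Fin (27 ^ (k / 6)) =>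
      (split k S T).get (j.cast (length_split k S T).symm) :=
  List.ext_get (by simp [length_split]) fun i _ _ => by simp

theorem countP_split_eq_sum {X : Type*} (A : Learner X) (k : ℕ) (S T : List (X × Label))
    (z : X × Label) :
    ((split k S T).countP fun L => A L z.1 ≠ z.2) =
      ∑ j, if allVoters A k S T j z.1 ≠ z.2 then 1 else 0 := by
  conv_lhs => rw [split_eq_ofFn k S T, countP_ofFn]
  rfl

/-- The region where at least a fraction `10 / 243` of all voters err. -/
def badRegion (A : Learner X) (k : ℕ) (S T : List (X × Label)) : Set (X × Label) :=
  {z | 10 * 27 ^ (k / 6) ≤ 243 * (split k S T).countP fun L => A L z.1 ≠ z.2}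

theorem MeasurableList.measurableSet_badRegion {A : Learner X} (hA : IsMeasurableLearner A)
    {S T : Ω → List (X × Label)} (hS : MeasurableList S) (hT : MeasurableList T) (k : ℕ) :
    MeasurableSet {p : Ω × (X × Label) | p.2 ∈ badRegion A k (S p.1) (T p.1)} := by
  have h : Measurable fun p : Ω × (X × Label) =>
      (split k (S p.1) (T p.1)).countP fun L => A L p.2.1 ≠ p.2.2 := by
    simp only [countP_split_eq_sum]
    exact Finset.measurable_fun_sum _ fun j _ => Measurable.ite
      (measurableSet_setOf_errSet (V := fun ω => allVoters A k (S ω) (T ω) j)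
        (hS.measurable_learner hA hT k j)) measurable_const
      measurable_const
  exact h (MeasurableSet.of_discrete (s := {c : ℕ | 10 * 27 ^ (k / 6) ≤ 243 * c}))

theorem measurableSet_badRegion {A : Learner X} (hA : IsMeasurableLearner A) (k : ℕ)
    (S T : List (X × Label)) : MeasurableSet (badRegion A k S T) :=
  measurable_prodMk_left (x := ()) ((MeasurableList.const (Ω := Unit) S).measurableSet_badRegion hA
    (MeasurableList.const T) k)

end MeasurableVoters

/-! ### Positions of heads and tails of blocks -/

section Blocks

variable {Z : Type*}

theorem three_pow_eq {k : ℕ} (hk : 6 ≤ k) :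
    3 ^ k = 729 * 3 ^ (k - 6) ∧ 3 ^ (k - 3) = 27 * 3 ^ (k - 6) := by
  obtain ⟨l, rfl⟩ := Nat.exists_eq_add_of_le hk
  have h₁ : 6 + l - 6 = l := by omega
  have h₂ : 6 + l - 3 = l + 3 := by omega
  rw [h₁, h₂]
  constructor <;> ring

theorem block_offset_le {k : ℕ} (hk : 6 ≤ k) (i : Fin 27) :
    (i : ℕ) * 3 ^ (k - 3) + 27 * 3 ^ (k - 6) ≤ 3 ^ k := by
  obtain ⟨h₁, h₂⟩ := three_pow_eq hk
  rw [h₁, h₂]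
  have := Nat.mul_le_mul_right (27 * 3 ^ (k - 6)) (Nat.le_of_lt_succ i.2)
  omega

/-- The positions of the first `3 ^ (k - 6)` entries of the block `i`. -/
def headEmb {k : ℕ} (hk : 6 ≤ k) (i : Fin 27) : Fin (3 ^ (k - 6)) ↪ Fin (3 ^ k) where
  toFun a := ⟨(i : ℕ) * 3 ^ (k - 3) + a, by have := block_offset_le hk i; omega⟩
  inj' a b h := by
    simp only [Fin.mk.injEq] at h
    ext; omega

/-- The positions of the remaining entries of the block `i`. -/
def tailEmb {k : ℕ} (hk : 6 ≤ k) (i : Fin 27) : Fin (26 * 3 ^ (k - 6)) ↪ Fin (3 ^ k) where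
  toFun a := ⟨(i : ℕ) * 3 ^ (k - 3) + 3 ^ (k - 6) + a, by have := block_offset_le hk i; omega⟩
  inj' a b h := by
    simp only [Fin.mk.injEq] at h
    ext; omega

theorem take_block {k : ℕ} (hk : 6 ≤ k) (s : Fin (3 ^ k) → Z) (i : Fin 27) :
    (block k (List.ofFn s) i).take (3 ^ (k - 6)) = List.ofFn (s ∘ headEmb hk i) := by
  have h := block_offset_le hk i
  have h' := (three_pow_eq hk).2
  refine List.ext_getElem ?_ fun a _ _ => ?_
  · simp [block]; omega
  · simp only [block, headEmb, List.getElem_take, List.getElem_drop, List.getElem_ofFn]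
    rfl

theorem drop_block {k : ℕ} (hk : 6 ≤ k) (s : Fin (3 ^ k) → Z) (i : Fin 27) :
    (block k (List.ofFn s) i).drop (3 ^ (k - 6)) = List.ofFn (s ∘ tailEmb hk i) := by
  have h := block_offset_le hk i
  have h' := (three_pow_eq hk).2
  refine List.ext_getElem ?_ fun a _ _ => ?_
  · simp [block]; omega
  · simp only [block, tailEmb, List.getElem_take, List.getElem_drop, List.getElem_ofFn,
      ← add_assoc]
    rfl

theorem headEmb_ne_tailEmb {k : ℕ} (hk : 6 ≤ k) (i j : Fin 27) (a : Fin (3 ^ (k - 6)))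
    (b : Fin (26 * 3 ^ (k - 6))) : headEmb hk i a ≠ tailEmb hk j b := by
  intro h
  have h' := (three_pow_eq hk).2
  have h₁ : (i : ℕ) * 3 ^ (k - 3) + a = j * 3 ^ (k - 3) + 3 ^ (k - 6) + b := congrArg Fin.val h
  rcases lt_trichotomy (i : ℕ) j with hij | hij | hij
  · have := Nat.mul_le_mul_right (3 ^ (k - 3)) (Nat.succ_le_of_lt hij)
    rw [Nat.succ_mul] at this
    omega
  · rw [hij] at h₁; omega
  · have := Nat.mul_le_mul_right (3 ^ (k - 3)) (Nat.succ_le_of_lt hij)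
    rw [Nat.succ_mul] at this
    omega

theorem tailEmb_ne_tailEmb {k : ℕ} (hk : 6 ≤ k) {i j : Fin 27} (hne : i ≠ j)
    (a b : Fin (26 * 3 ^ (k - 6))) : tailEmb hk i a ≠ tailEmb hk j b := by
  intro h
  have h' := (three_pow_eq hk).2
  have h₁ : (i : ℕ) * 3 ^ (k - 3) + 3 ^ (k - 6) + a = j * 3 ^ (k - 3) + 3 ^ (k - 6) + b :=
    congrArg Fin.val h
  rcases lt_trichotomy (i : ℕ) j with hij | hij | hij
  · have := Nat.mul_le_mul_right (3 ^ (k - 3)) (Nat.succ_le_of_lt hij)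
    rw [Nat.succ_mul] at this
    omega
  · exact hne (Fin.ext hij)
  · have := Nat.mul_le_mul_right (3 ^ (k - 3)) (Nat.succ_le_of_lt hij)
    rw [Nat.succ_mul] at this
    omega

theorem override_comp_self {ι κ : Type*} (f : ι ↪ κ) (s : κ → Z) (u : ι → Z) :
    override f s u ∘ f = u :=
  funext fun a => override_apply f s u a

theorem override_comp_of_ne {ι κ μ : Type*} (f : ι ↪ κ) (s : κ → Z) (u : ι → Z) (g : μ → κ)
    (h : ∀ a b, f a ≠ g b) : override f s u ∘ g = s ∘ g :=
  funext fun b => override_of_notMem f s u fun a => h a b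

end Blocks

/-! ### Covering the bad region by pairs of blocks -/

section Recursion

open Classical in
/-- If every point of `R` lies in enough of the sets `B p`, then `R` is small. -/
theorem mul_measureReal_le_sum {Z P : Type*} [MeasurableSpace Z] (D : Measure Z)
    [IsProbabilityMeasure D] [Fintype P] {R : Set Z} (hR : MeasurableSet R) {B : P → Set Z}
    (hB : ∀ p, MeasurableSet (B p)) (N c : ℕ)
    (h : ∀ z ∈ R, N ≤ c * ∑ p, if z ∈ B p then 1 else 0) :
    N * D.real R ≤ c * ∑ p, D.real (B p) := by
  have hi {E : Set Z} (hE : MeasurableSet E) : Integrable (E.indicator (1 : Z → ℝ)) D :=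
    (integrable_const (1 : ℝ)).indicator hE
  have h₁ : ∫ z, N * R.indicator (1 : Z → ℝ) z ∂D ≤
      ∫ z, c * ∑ p, (B p).indicator (1 : Z → ℝ) z ∂D := by
    refine integral_mono ((hi hR).const_mul _)
      ((integrable_finsetSum _ fun p _ => hi (hB p)).const_mul _) fun z => ?_
    have hs : ∑ p, (B p).indicator (1 : Z → ℝ) z = ((∑ p, if z ∈ B p then 1 else 0 : ℕ) : ℝ) := by
      simp [Set.indicator_apply]
    simp only [hs]
    by_cases hz : z ∈ R
    · simp only [Set.indicator_of_mem hz, Pi.one_apply, mul_one]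
      exact_mod_cast h z hz
    · simp only [Set.indicator_of_notMem hz, mul_zero]
      positivity
  rwa [integral_const_mul, integral_const_mul, integral_indicator_one hR,
    integral_finsetSum _ fun p _ => hi (hB p),
    Finset.sum_congr rfl fun p _ => integral_indicator_one (hB p)] at h₁

/-- If at least a `10 / 243` fraction of the votes is bad, then some block has the same property
and the other blocks still contribute a constant fraction of bad votes. -/
theorem exists_block_of_votes {Q : ℕ} {c : Fin 27 → ℕ} (hc : ∀ i, c i ≤ Q)
    (h : 10 * (27 * Q) ≤ 243 * ∑ i, c i) :
    ∃ i, 10 * Q ≤ 243 * c i ∧ Q ≤ 9 * ∑ j, if i ≠ j then c j else 0 := by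
  -- The maximum is at least the average. The total is at least `10 * Q / 9` and block `i` accounts
  -- for at most `Q`, which leaves `Q / 9`.
  obtain ⟨i, -, hi⟩ := Finset.exists_max_image Finset.univ c Finset.univ_nonempty
  refine ⟨i, ?_, ?_⟩
  · have : ∑ j, c j ≤ 27 * c i := by
      simpa using Finset.sum_le_card_nsmul Finset.univ c (c i) fun j _ => hi j (Finset.mem_univ j)
    omega
  · have h₁ : ∑ j, c j = c i + ∑ j, if i ≠ j then c j else 0 := by
      rw [← Finset.sum_erase_add _ _ (Finset.mem_univ i), add_comm, ← Finset.sum_filter]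
      congr 2
      ext j
      simp [eq_comm]
    have := hc i
    omega

variable {X : Type*}

/-- The head of the block `i` of the sample `s`. -/
def headPart {Z : Type*} {k : ℕ} (hk : 6 ≤ k) (s : Fin (3 ^ k) → Z) (i : Fin 27) : List Z :=
  List.ofFn (s ∘ headEmb hk i)

/-- The tail of the block `i` of the sample `s`, followed by `T`. -/
def tailPart {Z : Type*} {k : ℕ} (hk : 6 ≤ k) (s : Fin (3 ^ k) → Z) (T : List Z) (i : Fin 27) :
    List Z :=
  List.ofFn (s ∘ tailEmb hk i) ++ T

theorem countP_split_blocks {Z : Type*} (p : List Z → Bool) {k : ℕ} (hk : 6 ≤ k)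
    (s : Fin (3 ^ k) → Z) (T : List Z) :
    (split k (List.ofFn s) T).countP p =
      ∑ i, (split (k - 6) (headPart hk s i) (tailPart hk s T i)).countP p := by
  rw [countP_split_of_le p hk, ← Fin.sum_univ_eq_sum_range
    (fun i => (split (k - 6) ((block k (List.ofFn s) i).take (3 ^ (k - 6)))
        ((block k (List.ofFn s) i).drop (3 ^ (k - 6)) ++ T)).countP p) 27]
  refine Finset.sum_congr rfl fun i _ => ?_
  rw [take_block hk, drop_block hk]
  rfl

theorem errCount_parts_le {k : ℕ} (hk : 6 ≤ k) (s : Fin (3 ^ k) → X × Label)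
    (T : List (X × Label)) (i : Fin 27) (h : Hyp X) :
    errCount h (headPart hk s i) + errCount h (tailPart hk s T i) ≤
      errCount h (List.ofFn s ++ T) := by
  have h₁ := countP_take_add_drop (fun z : X × Label => h z.1 ≠ z.2) (3 ^ (k - 6))
    (block k (List.ofFn s) i)
  have h₂ := countP_block_le (fun z : X × Label => h z.1 ≠ z.2) k (List.ofFn s) i
  rw [take_block hk, drop_block hk] at h₁
  simp only [errCount, headPart, tailPart, List.countP_append]
  omega

/-- The training sequence contains the tail, the voter errs on it no more than `h` does, and it is
contained in the whole input. -/
theorem IsERM.errCount_tail_le {H : Set (Hyp X)} {A : Learner X} (hA : IsERM H A) {h : Hyp X}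
    (hh : h ∈ H) {k : ℕ} (hk : 6 ≤ k) (s : Fin (3 ^ k) → X × Label) (T : List (X × Label))
    (j : Fin 27) (q : Fin (27 ^ ((k - 6) / 6))) :
    errCount (allVoters A (k - 6) (headPart hk s j) (tailPart hk s T j) q)
      (List.ofFn (s ∘ tailEmb hk j)) ≤ errCount h (List.ofFn s ++ T) := by
  set L := (split (k - 6) (headPart hk s j) (tailPart hk s T j)).get
    (q.cast (length_split _ _ _).symm) with hL
  have hmem : L ∈ split (k - 6) (headPart hk s j) (tailPart hk s T j) := List.get_mem _ _
  have h₁ := (countP_le_of_mem_split (fun z : X × Label => A L z.1 ≠ z.2) _ _ _ hmem).1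
  have h₂ := (countP_le_of_mem_split (fun z : X × Label => h z.1 ≠ z.2) _ _ _ hmem).2
  have h₃ := hA.countP_le L hh
  have h₄ := errCount_parts_le hk s T j h
  have h₅ : (List.ofFn (s ∘ tailEmb hk j)).countP (fun z : X × Label => A L z.1 ≠ z.2) ≤
      (tailPart hk s T j).countP fun z : X × Label => A L z.1 ≠ z.2 := by
    rw [tailPart, List.countP_append]; omega
  exact h₅.trans (h₁.trans (h₃.trans (h₂.trans h₄)))

variable [MeasurableSpace X]

/-- If within the bad region of each block every voter of every other block has small error, then
the bad region of the whole sample is small. -/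
theorem measureReal_badRegion_le (D : Measure (X × Label)) [IsProbabilityMeasure D]
    {A : Learner X} (hA : IsMeasurableLearner A) {k : ℕ} (hk : 6 ≤ k)
    (s : Fin (3 ^ k) → X × Label) (T : List (X × Label)) {β : ℝ} (hβ : 0 ≤ β)
    (h : ∀ i j, i ≠ j → ∀ q,
      D.real (badRegion A (k - 6) (headPart hk s i) (tailPart hk s T i) ∩
        errSet (allVoters A (k - 6) (headPart hk s j) (tailPart hk s T j) q)) ≤ β) :
    D.real (badRegion A k (List.ofFn s) T) ≤ 9 * 729 * β := by
  classical
  set Q := 27 ^ ((k - 6) / 6) with hQ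
  have hkQ : 27 ^ (k / 6) = 27 * Q := by
    rw [hQ, ← pow_succ']; congr 1; omega
  let V : Fin 27 → Fin Q → Hyp X := fun j =>
    allVoters A (k - 6) (headPart hk s j) (tailPart hk s T j)
  let R : Fin 27 → Set (X × Label) := fun i =>
    badRegion A (k - 6) (headPart hk s i) (tailPart hk s T i)
  have hV (j : Fin 27) (q : Fin Q) : MeasurableSet (errSet (V j q)) := by
    refine measurableSet_errSet ?_
    exact ((MeasurableList.const (Ω := Unit) _).measurable_learner hA (MeasurableList.const _)
      (k - 6) q).comp (measurable_prodMk_left (x := ()))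
  -- Pairs with `i = j` are discarded: a voter is controlled only on the bad region of another
  -- block.
  let B : Fin 27 × Fin 27 × Fin Q → Set (X × Label) := fun p =>
    if p.1 ≠ p.2.1 then R p.1 ∩ errSet (V p.2.1 p.2.2) else ∅
  have hB (p) : MeasurableSet (B p) := by
    simp only [B]
    split_ifs
    · exact (measurableSet_badRegion hA _ _ _).inter (hV _ _)
    · exact MeasurableSet.empty
  have hBβ (p) : D.real (B p) ≤ β := by
    simp only [B]
    split_ifs with hp
    · exact h _ _ hp _
    · simpa using hβ
  have hcover := mul_measureReal_le_sum D (measurableSet_badRegion hA k (List.ofFn s) T) hB Q 9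
    fun z hz => by
      let c : Fin 27 → ℕ := fun j => ∑ q, if z ∈ errSet (V j q) then 1 else 0
      have hcount (j : Fin 27) : (split (k - 6) (headPart hk s j) (tailPart hk s T j)).countP
          (fun L => A L z.1 ≠ z.2) = c j := by
        rw [countP_split_eq_sum]
        exact Finset.sum_congr rfl fun q _ => if_congr Iff.rfl rfl rfl
      have hz' : 10 * (27 * Q) ≤ 243 * ∑ j, c j := by
        have : 10 * 27 ^ (k / 6) ≤ 243 * (split k (List.ofFn s) T).countP
          (fun L => A L z.1 ≠ z.2) := hz
        rw [countP_split_blocks _ hk, hkQ] at this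
        simpa only [hcount] using this
      have hcQ (j : Fin 27) : c j ≤ Q := by
        calc c j ≤ ∑ _q : Fin Q, 1 := Finset.sum_le_sum fun q _ => by split_ifs <;> simp
          _ = Q := by simp
      obtain ⟨i, hi, hle⟩ := exists_block_of_votes hcQ hz'
      have hiR : z ∈ R i := by
        change 10 * Q ≤ 243 * _
        rwa [hcount]
      refine hle.trans (Nat.mul_le_mul_left 9 ?_)
      rw [Fintype.sum_prod_type]
      refine le_trans ?_ (Finset.single_le_sum (fun _ _ => Nat.zero_le _) (Finset.mem_univ i))
      rw [Fintype.sum_prod_type]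
      refine Finset.sum_le_sum fun j _ => ?_
      by_cases hij : i = j
      · simp [hij]
      · simp [hij, B, c, hiR]
  have hsum : ∑ p, D.real (B p) ≤ 729 * Q * β := by
    calc ∑ p, D.real (B p) ≤ ∑ _p : Fin 27 × Fin 27 × Fin Q, β :=
          Finset.sum_le_sum fun p _ => hBβ p
      _ = 729 * Q * β := by
          rw [Finset.sum_const, nsmul_eq_mul, Finset.card_univ, Fintype.card_prod,
            Fintype.card_prod, Fintype.card_fin, Fintype.card_fin]
          push_cast
          ring
  have hQpos : (0 : ℝ) < Q := by rw [hQ]; positivity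
  push_cast at hcover
  refine le_of_mul_le_mul_left ?_ hQpos
  calc _ ≤ 9 * ∑ p, D.real (B p) := hcover
    _ ≤ 9 * (729 * Q * β) := by gcongr
    _ = Q * (9 * 729 * β) := by ring

end Recursion

/-! ### The induction along the splitting -/

section Recursion

variable {X : Type*} [MeasurableSpace X]

theorem log_exp_one_div {δ : ℝ} (hδ : 0 < δ) :
    Real.log (Real.exp 1 / δ) = 1 + Real.log (1 / δ) := by
  rw [Real.log_div (Real.exp_pos 1).ne' hδ.ne', Real.log_exp, one_div, Real.log_inv]
  ring

/-- The additive price of lowering the failure probability from `δ` to `δ / a` in a union bound,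
using `log 2 ≤ 1`. -/
theorem log_inv_div_le {δ : ℝ} (hδ : 0 < δ) {a : ℝ} (ha : 0 < a) {n : ℕ} (h : a ≤ 2 ^ n) :
    Real.log (1 / (δ / a)) ≤ Real.log (1 / δ) + n := by
  have h₁ : Real.log a ≤ n := by
    calc Real.log a ≤ Real.log (2 ^ n) := Real.log_le_log ha h
      _ = n * Real.log 2 := by rw [Real.log_pow]
      _ ≤ n * 1 := by
          have := Real.log_two_lt_d9
          gcongr
          linarith
      _ = n := mul_one _
  rw [one_div_div, one_div, Real.log_inv, Real.log_div ha.ne' hδ.ne']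
  linarith

/-- The bad region of block `i` is larger than the inductive bound allows. -/
def regionFailure (D : Measure (X × Label)) (A : Learner X) (h : Hyp X) (d : ℕ) {k : ℕ}
    (hk : 6 ≤ k) (T : List (X × Label)) (δ : ℝ) (i : Fin 27) : Set (Fin (3 ^ k) → X × Label) :=
  {s | 3 ^ 18 * (errCount h (headPart hk s i ++ tailPart hk s T i) + d +
      Real.log (Real.exp 1 / δ)) <
    (3 : ℝ) ^ (k - 6) * D.real (badRegion A (k - 6) (headPart hk s i) (tailPart hk s T i))}

/-- Some voter of block `j` has a large error within the bad region of block `i`, compared with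
its number of errors on the tail of block `j`. -/
def voterFailure (D : Measure (X × Label)) (A : Learner X) (d : ℕ) {k : ℕ}
    (hk : 6 ≤ k) (T : List (X × Label)) (δ : ℝ) (i j : Fin 27) :
    Set (Fin (3 ^ k) → X × Label) :=
  {s | ∃ q, 3 * (errCount (allVoters A (k - 6) (headPart hk s j) (tailPart hk s T j) q)
        (List.ofFn (s ∘ tailEmb hk j)) + d * Real.log (1 / (1 / 3 ^ 18)) +
      2 * (26 * 3 ^ (k - 6) : ℕ) * (1 / 3 ^ 18) *
        D.real (badRegion A (k - 6) (headPart hk s i) (tailPart hk s T i)) +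
      Real.log (1 / δ)) < (26 * 3 ^ (k - 6) : ℕ) *
    D.real (badRegion A (k - 6) (headPart hk s i) (tailPart hk s T i) ∩
      errSet (allVoters A (k - 6) (headPart hk s j) (tailPart hk s T j) q))}

theorem measurableList_headPart {k : ℕ} (hk : 6 ≤ k) (i : Fin 27) :
    MeasurableList fun s : Fin (3 ^ k) → X × Label => headPart hk s i :=
  MeasurableList.ofFn (measurable_pi_iff.2 fun a => measurable_pi_apply (headEmb hk i a))

theorem measurableList_ofFn_tailEmb {k : ℕ} (hk : 6 ≤ k) (i : Fin 27) :
    MeasurableList fun s : Fin (3 ^ k) → X × Label => List.ofFn (s ∘ tailEmb hk i) :=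
  MeasurableList.ofFn (measurable_pi_iff.2 fun a => measurable_pi_apply (tailEmb hk i a))

theorem measurableList_tailPart {k : ℕ} (hk : 6 ≤ k) (T : List (X × Label)) (i : Fin 27) :
    MeasurableList fun s : Fin (3 ^ k) → X × Label => tailPart hk s T i :=
  (measurableList_ofFn_tailEmb hk i).append (MeasurableList.const T)

theorem measurable_measureReal_badRegion (D : Measure (X × Label)) [IsProbabilityMeasure D]
    {A : Learner X} (hA : IsMeasurableLearner A) {Ω : Type*} [MeasurableSpace Ω]
    {S T : Ω → List (X × Label)} (hS : MeasurableList S) (hT : MeasurableList T) (k : ℕ) :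
    Measurable fun ω => D.real (badRegion A k (S ω) (T ω)) :=
  (measurable_measure_prodMk_left (hS.measurableSet_badRegion hA hT k)).ennreal_toReal

theorem measurableSet_regionFailure (D : Measure (X × Label)) [IsProbabilityMeasure D]
    {A : Learner X} (hA : IsMeasurableLearner A) {h : Hyp X} (hh : Measurable h) (d : ℕ) {k : ℕ}
    (hk : 6 ≤ k) (T : List (X × Label)) (δ : ℝ) (i : Fin 27) :
    MeasurableSet (regionFailure D A h d hk T δ i) := by
  have h₁ : Measurable fun s : Fin (3 ^ k) → X × Label =>
      ((errCount h (headPart hk s i ++ tailPart hk s T i) : ℕ) : ℝ) :=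
    measurable_from_top.comp
      (((measurableList_headPart hk i).append (measurableList_tailPart hk T i)).measurable_errCount
        (V := fun _ => h) (hh.comp measurable_snd))
  exact measurableSet_lt (((h₁.add_const _).add_const _).const_mul _)
    ((measurable_measureReal_badRegion D hA (measurableList_headPart hk i)
      (measurableList_tailPart hk T i) (k - 6)).const_mul _)

theorem measurableSet_voterFailure (D : Measure (X × Label)) [IsProbabilityMeasure D]
    {A : Learner X} (hA : IsMeasurableLearner A) (d : ℕ) {k : ℕ}
    (hk : 6 ≤ k) (T : List (X × Label)) (δ : ℝ) (i j : Fin 27) :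
    MeasurableSet (voterFailure D A d hk T δ i j) := by
  have hV (q) := (measurableList_headPart hk j).measurable_learner hA
    (measurableList_tailPart hk T j) (k - 6) q
  have hR := (measurableList_headPart hk i).measurableSet_badRegion hA
    (measurableList_tailPart hk T i) (k - 6)
  rw [voterFailure, Set.ofPred_exists]
  refine MeasurableSet.iUnion fun q => ?_
  have h₁ : Measurable fun s : Fin (3 ^ k) → X × Label =>
      ((errCount (allVoters A (k - 6) (headPart hk s j) (tailPart hk s T j) q)
        (List.ofFn (s ∘ tailEmb hk j)) : ℕ) : ℝ) :=
    measurable_from_top.comp ((measurableList_ofFn_tailEmb hk j).measurable_errCount (hV q))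
  have h₂ := measurable_measureReal_badRegion D hA (measurableList_headPart hk i)
      (measurableList_tailPart hk T i) (k - 6)
  have h₃ : Measurable fun s : Fin (3 ^ k) → X × Label =>
      D.real (badRegion A (k - 6) (headPart hk s i) (tailPart hk s T i) ∩
        errSet (allVoters A (k - 6) (headPart hk s j) (tailPart hk s T j) q)) :=
    (measurable_measure_prodMk_left
      (hR.inter (measurableSet_setOf_errSet
        (V := fun s => allVoters A (k - 6) (headPart hk s j) (tailPart hk s T j) q) (hV q)))).ennreal_toReal
  exact measurableSet_lt ((((h₁.add_const _).add (h₂.const_mul _)).add_const _).const_mul _)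
    (h₃.const_mul _)

/-- Fix all coordinates but the tail of block `j`. As `i ≠ j`, the bad region of block `i` is then
constant, while the voters of block `j` are members of `H` selected by the fresh sample `u`, so the
relative deviation bound applies. -/
theorem pi_voterFailure_le (D : Measure (X × Label)) [IsProbabilityMeasure D]
    {H : Set (Hyp X)} {d : ℕ} (hd : HasVCDim H d) {A : Learner X} (hERM : IsERM H A)
    (hA : IsMeasurableLearner A) {k : ℕ} (hk : 6 ≤ k) (T : List (X × Label)) {δ : ℝ}
    (hδ : 0 < δ) {i j : Fin 27} (hij : i ≠ j) :
    (Measure.pi fun _ => D) (voterFailure D A d hk T δ i j) ≤ ENNReal.ofReal δ := by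
  refine pi_le_of_override_le D (tailEmb hk j) (measurableSet_voterFailure D hA d hk T δ i j)
    fun s => ?_
  have e₁ (u) (l : Fin 27) : headPart hk (override (tailEmb hk j) s u) l = headPart hk s l := by
    rw [headPart, override_comp_of_ne _ _ _ _ fun a b => (headEmb_ne_tailEmb hk l j b a).symm]
    rfl
  have e₂ (u) : tailPart hk (override (tailEmb hk j) s u) T i = tailPart hk s T i := by
    rw [tailPart, override_comp_of_ne _ _ _ _ fun a b => (tailEmb_ne_tailEmb hk hij b a).symm]
    rfl
  have e₃ (u) : override (tailEmb hk j) s u ∘ tailEmb hk j = u := override_comp_self _ _ _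
  have e₄ (u) : tailPart hk (override (tailEmb hk j) s u) T j = List.ofFn u ++ T := by
    rw [tailPart, e₃]
  simp only [voterFailure, Set.mem_ofPred_eq, e₁, e₂, e₃, e₄]
  exact pi_exists_excess_le hd D (measurableSet_badRegion hA _ _ _) (by positivity) (by norm_num)
    (fun q u => allVoters A (k - 6) (headPart hk s j) (List.ofFn u ++ T) q)
    (fun q u => (hERM _).1)
    (fun q => (MeasurableList.const _).measurable_learner hA
      ((MeasurableList.ofFn measurable_id).append (MeasurableList.const T)) (k - 6) q) hδ

/-- The deterministic half of the inductive step: off the failure events the same constant `3 ^ 18`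
reappears. Taking `x = 1 / 3 ^ 18` in the deviation bound cancels that constant in the inductive
estimate of the region. -/
theorem badRegion_bound_of_notMem (D : Measure (X × Label)) [IsProbabilityMeasure D]
    {H : Set (Hyp X)} (d : ℕ) {A : Learner X} (hERM : IsERM H A)
    (hA : IsMeasurableLearner A) {h : Hyp X} (hh : h ∈ H) {k : ℕ} (hk : 6 ≤ k)
    (T : List (X × Label)) {δ : ℝ} (hδ : 0 < δ) (hδ1 : δ ≤ 1) {s : Fin (3 ^ k) → X × Label}
    (h₁ : ∀ i, s ∉ regionFailure D A h d hk T (δ / 54) i)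
    (h₂ : ∀ i j, i ≠ j → s ∉ voterFailure D A d hk T (δ / 1458) i j) :
    (3 : ℝ) ^ k * D.real (badRegion A k (List.ofFn s) T) ≤
      3 ^ 18 * (errCount h (List.ofFn s ++ T) + d + Real.log (Real.exp 1 / δ)) := by
  have hlog : 0 ≤ Real.log (1 / δ) := Real.log_nonneg (by rw [le_div_iff₀ hδ]; linarith)
  have h54 := log_inv_div_le hδ (a := 54) (n := 6) (by norm_num) (by norm_num)
  have h1458 := log_inv_div_le hδ (a := 1458) (n := 11) (by norm_num) (by norm_num)
  have hC : Real.log (1 / (1 / 3 ^ 18)) ≤ 36 := by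
    rw [one_div_one_div, Real.log_pow]
    have := Real.log_le_sub_one_of_pos (x := 3) (by norm_num)
    push_cast
    linarith
  set E : ℝ := ((errCount h (List.ofFn s ++ T) : ℕ) : ℝ)
  set N : ℝ := (3 : ℝ) ^ (k - 6) with hN
  have hNpos : 0 < N := by positivity
  have hE : 0 ≤ E := Nat.cast_nonneg _
  have hd : (0 : ℝ) ≤ d := Nat.cast_nonneg _
  rw [log_exp_one_div hδ]
  set L := Real.log (1 / δ)
  set B : ℝ := E + d + (1 + L) with hB
  have hBpos : 0 < B := by positivity
  -- Passing to `δ / 54` adds at most 6 to the logarithm, and `B ≥ 1`.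
  have hregion (i : Fin 27) :
      N * D.real (badRegion A (k - 6) (headPart hk s i) (tailPart hk s T i)) ≤ 3 ^ 18 * (7 * B) := by
    have hi := h₁ i
    rw [regionFailure, Set.mem_ofPred_eq, not_lt] at hi
    refine hi.trans ?_
    gcongr
    have he : ((errCount h (headPart hk s i ++ tailPart hk s T i) : ℕ) : ℝ) ≤ E := by
      refine Nat.cast_le.2 (le_of_eq_of_le ?_ (errCount_parts_le hk s T i h))
      simp [errCount]
    rw [log_exp_one_div (by positivity)]
    push_cast at h54
    linarith
  -- Here 1200 = 3 (36 + 2·26·7): the region term is at most 2·26·7 `B`, and the remaining terms `E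
  -- + 36 d + L + 11` are at most 36 `B`.
  have hvoter (i j : Fin 27) (hij : i ≠ j) (q) :
      D.real (badRegion A (k - 6) (headPart hk s i) (tailPart hk s T i) ∩
        errSet (allVoters A (k - 6) (headPart hk s j) (tailPart hk s T j) q)) ≤
      1200 * B / (26 * N) := by
    have hq := h₂ i j hij
    rw [voterFailure, Set.mem_ofPred_eq, not_exists] at hq
    replace hq := not_lt.1 (hq q)
    have he : ((errCount (allVoters A (k - 6) (headPart hk s j) (tailPart hk s T j) q)
        (List.ofFn (s ∘ tailEmb hk j)) : ℕ) : ℝ) ≤ E :=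
      Nat.cast_le.2 (hERM.errCount_tail_le hh hk s T j q)
    have hdC : d * Real.log (1 / (1 / 3 ^ 18)) ≤ d * 36 := by gcongr
    have hr := hregion i
    push_cast at hq h1458
    rw [← hN] at hq
    rw [le_div_iff₀ (by positivity)]
    linarith
  have hfin := measureReal_badRegion_le D hA hk s T (β := 1200 * B / (26 * N)) (by positivity)
    hvoter
  have h3k : (3 : ℝ) ^ k = 729 * N := by
    rw [hN]; exact_mod_cast (three_pow_eq hk).1
  rw [h3k]
  calc 729 * N * D.real (badRegion A k (List.ofFn s) T)
      ≤ 729 * N * (9 * 729 * (1200 * B / (26 * N))) := by gcongr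
    _ = 729 * 9 * 729 * 1200 / 26 * B := by field_simp
    -- The left constant is about 2.2·10^8 and `3 ^ 18` about 3.9·10^8, so the induction closes.
    _ ≤ 3 ^ 18 * B := by gcongr; norm_num

/-- With high probability over `s`, the region where a `10 / 243` fraction of all voters err is
small in terms of the number of errors of any fixed `h ∈ H` on the whole input. -/
theorem pi_badRegion_le (D : Measure (X × Label)) [IsProbabilityMeasure D]
    {H : Set (Hyp X)} {d : ℕ} (hd : HasVCDim H d) {A : Learner X} (hERM : IsERM H A)
    (hA : IsMeasurableLearner A) {h : Hyp X} (hh : h ∈ H) (hhm : Measurable h) (k : ℕ)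
    (T : List (X × Label)) {δ : ℝ} (hδ : 0 < δ) (hδ1 : δ ≤ 1) :
    (Measure.pi fun _ : Fin (3 ^ k) => D)
      {s | 3 ^ 18 * (errCount h (List.ofFn s ++ T) + d + Real.log (Real.exp 1 / δ)) <
        (3 : ℝ) ^ k * D.real (badRegion A k (List.ofFn s) T)} ≤ ENNReal.ofReal δ := by
  induction k using Nat.strong_induction_on generalizing T δ with
  | _ k ih =>
  -- For `k < 6` the failure event is empty: `3 ^ k ≤ 3 ^ 18`, the mass is at most 1, and `log (e /
  -- δ) ≥ 1`.
  rcases lt_or_ge k 6 with hk | hk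
  · refine le_of_eq_of_le (measure_mono_null (t := ∅) (fun s hs => ?_) measure_empty) zero_le
    have hlog : 0 ≤ Real.log (1 / δ) := Real.log_nonneg (by rw [le_div_iff₀ hδ]; linarith)
    have h₁ : (3 : ℝ) ^ k ≤ 3 ^ 18 := pow_le_pow_right₀ (by norm_num) (by omega)
    have h₂ : D.real (badRegion A k (List.ofFn s) T) ≤ 1 := measureReal_le_one
    rw [Set.mem_ofPred_eq] at hs
    refine absurd hs (not_lt.2 ?_)
    rw [log_exp_one_div hδ]
    refine mul_le_mul h₁ (h₂.trans ?_) measureReal_nonneg (by positivity)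
    have : (0 : ℝ) ≤ errCount h (List.ofFn s ++ T) + d := by positivity
    linarith
  · have hregion (i : Fin 27) : (Measure.pi fun _ => D)
        (regionFailure D A h d hk T (δ / 54) i) ≤ ENNReal.ofReal (δ / 54) := by
      -- Once all but the head of block `i` is fixed, the induction hypothesis applies with
      -- `tailPart hk s T i` in place of `T`; hence the induction over all `T`.
      refine pi_le_of_override_le D (headEmb hk i)
        (measurableSet_regionFailure D hA hhm d hk T _ i) fun s => ?_
      have e₁ (u) : headPart hk (override (headEmb hk i) s u) i = List.ofFn u := by
        rw [headPart, override_comp_self]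
      have e₂ (u) : tailPart hk (override (headEmb hk i) s u) T i = tailPart hk s T i := by
        rw [tailPart, override_comp_of_ne _ _ _ _ fun a b => headEmb_ne_tailEmb hk i i a b]
        rfl
      simp only [regionFailure, Set.mem_ofPred_eq, e₁, e₂]
      exact ih (k - 6) (by omega) (tailPart hk s T i) (by positivity) (by linarith)
    have hvoter (p : Fin 27 × Fin 27) : (Measure.pi fun _ => D)
        {s | p.1 ≠ p.2 ∧ s ∈ voterFailure D A d hk T (δ / 1458) p.1 p.2} ≤
          ENNReal.ofReal (δ / 1458) := by
      by_cases hp : p.1 = p.2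
      · simp [hp]
      · simpa [hp] using pi_voterFailure_le D hd hERM hA hk T (δ := δ / 1458) (by positivity) hp
    calc _ ≤ (Measure.pi fun _ => D) ((⋃ i, regionFailure D A h d hk T (δ / 54) i) ∪
          ⋃ p : Fin 27 × Fin 27,
            {s | p.1 ≠ p.2 ∧ s ∈ voterFailure D A d hk T (δ / 1458) p.1 p.2}) := by
          refine measure_mono fun s hs => ?_
          by_contra hcon
          simp only [Set.mem_union, Set.mem_iUnion, not_or, not_exists, Set.mem_ofPred_eq,
            not_and] at hcon
          exact absurd (show _ < _ from hs) (not_lt.2 (badRegion_bound_of_notMem D d hERM hA hh hk T hδ hδ1 hcon.1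
            fun i j => hcon.2 (i, j)))
      -- The failure budget is 27/54 + 27²/1458 = 1.
      _ ≤ ∑ _i : Fin 27, ENNReal.ofReal (δ / 54) +
          ∑ _p : Fin 27 × Fin 27, ENNReal.ofReal (δ / 1458) := by
          refine (measure_union_le _ _).trans (add_le_add ?_ ?_)
          · exact (measure_iUnion_fintype_le _ _).trans (Finset.sum_le_sum fun i _ => hregion i)
          · exact (measure_iUnion_fintype_le _ _).trans (Finset.sum_le_sum fun p _ => hvoter p)
      _ = ENNReal.ofReal δ := by
          rw [← ENNReal.ofReal_sum_of_nonneg fun _ _ => by positivity,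
            ← ENNReal.ofReal_sum_of_nonneg fun _ _ => by positivity,
            ← ENNReal.ofReal_add (Finset.sum_nonneg fun _ _ => by positivity)
              (Finset.sum_nonneg fun _ _ => by positivity)]
          congr 1
          simp only [Finset.sum_const, Finset.card_univ, Fintype.card_prod, Fintype.card_fin,
            nsmul_eq_mul]
          push_cast
          ring

end Recursion

/-! ### Chernoff bounds and the random draw of voters -/

section Draws

theorem ofReal_one_add_mul_pow_le {a b : ℝ} (ha : 0 ≤ a) (hb : 0 ≤ b) (n : ℕ) :
    (1 + ENNReal.ofReal a * ENNReal.ofReal b) ^ n ≤ ENNReal.ofReal (Real.exp (n * (a * b))) := by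
  rw [← ENNReal.ofReal_one, ← ENNReal.ofReal_mul ha, ← ENNReal.ofReal_add zero_le_one
    (by positivity), ← ENNReal.ofReal_pow (by positivity), Real.exp_nat_mul]
  refine ENNReal.ofReal_le_ofReal ?_
  gcongr
  rw [add_comm]
  exact Real.add_one_le_exp _

open Classical in
/-- An exponential moment bound for the number of coordinates in `B`. -/
theorem pi_card_mem_le {Z : Type*} [MeasurableSpace Z] (D : Measure Z) [IsProbabilityMeasure D]
    {B : Set Z} (hB : MeasurableSet B) {n : ℕ} {θ : ℝ} (hθ : 0 ≤ θ) (a : ℝ) :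
    (Measure.pi fun _ : Fin n => D) {s | a ≤ ∑ i, if s i ∈ B then 1 else 0} ≤
      ENNReal.ofReal (Real.exp (n * ((Real.exp θ - 1) * D.real B) - θ * a)) := by
  have hy : 0 ≤ Real.exp θ - 1 := by linarith [Real.add_one_le_exp θ]
  have hu := measurable_upWeight (Real.exp θ - 1).toNNReal hB
  have hintegral := lintegral_pi_prod (ι := Fin n) D hu
  rw [lintegral_upWeight D _ hB, Fintype.card_fin] at hintegral
  have hle : ∫⁻ s, ∏ i, upWeight (Real.exp θ - 1).toNNReal B (s i) ∂(Measure.pi fun _ : Fin n => D)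
      ≤ ENNReal.ofReal (Real.exp (n * ((Real.exp θ - 1) * D.real B))) := by
    rw [hintegral, ← ofReal_measureReal (μ := D) (s := B)]
    exact ofReal_one_add_mul_pow_le hy measureReal_nonneg n
  have hval (s : Fin n → Z) : ∏ i, upWeight (Real.exp θ - 1).toNNReal B (s i) =
      ENNReal.ofReal (Real.exp (θ * ∑ i, if s i ∈ B then 1 else 0)) := by
    rw [Finset.mul_sum, Real.exp_sum, ENNReal.ofReal_prod_of_nonneg fun _ _ => (Real.exp_pos _).le]
    refine Finset.prod_congr rfl fun i _ => ?_
    by_cases hi : s i ∈ B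
    · simp only [upWeight, hi, Set.indicator_of_mem, Pi.one_apply, mul_one, if_true]
      change 1 + ENNReal.ofReal (Real.exp θ - 1) = _
      rw [← ENNReal.ofReal_one, ← ENNReal.ofReal_add zero_le_one hy]
      congr 1
      ring
    · simp [upWeight, hi]
  have hsub : {s : Fin n → Z | a ≤ ∑ i, if s i ∈ B then 1 else 0} ⊆
      {s | ENNReal.ofReal (Real.exp (θ * a)) ≤ ∏ i, upWeight (Real.exp θ - 1).toNNReal B (s i)} := by
    intro s hs
    rw [Set.mem_ofPred_eq] at hs ⊢
    rw [hval]
    exact ENNReal.ofReal_le_ofReal (Real.exp_le_exp.2 (mul_le_mul_of_nonneg_left hs hθ))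
  have hmarkov := ((mul_le_mul_right (measure_mono hsub) _).trans
    (mul_meas_ge_le_lintegral (μ := Measure.pi fun _ : Fin n => D)
      (Finset.measurable_fun_prod _ fun i _ => hu.comp (measurable_pi_apply i)) _)).trans hle
  have hpos := ENNReal.ofReal_pos.2 (Real.exp_pos (θ * a))
  rw [← ENNReal.mul_le_mul_iff_right hpos.ne' ENNReal.ofReal_ne_top]
  refine hmarkov.trans (le_of_eq ?_)
  rw [← ENNReal.ofReal_mul (Real.exp_pos _).le, ← Real.exp_add]
  congr 2
  ring

variable {X : Type*} [MeasurableSpace X]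

/-- The number of errors of a fixed hypothesis on a random sample. -/
theorem pi_errCount_le (D : Measure (X × Label)) [IsProbabilityMeasure D] {h : Hyp X}
    (hh : Measurable h) {n : ℕ} {δ : ℝ} (hδ : 0 < δ) :
    (Measure.pi fun _ : Fin n => D)
      {s | 2 * (n * trueError D h + Real.log (1 / δ)) < errCount h (List.ofFn s)} ≤
      ENNReal.ofReal δ := by
  classical
  have hl2 : 0 ≤ Real.log 2 := Real.log_nonneg (by norm_num)
  have hτ : 0 ≤ trueError D h := measureReal_nonneg
  -- A negative threshold forces `δ ≥ 1`, and the bound is trivial.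
  by_cases hneg : n * trueError D h + Real.log (1 / δ) < 0
  · have h1 : 1 ≤ δ := by
      have : Real.log (1 / δ) < 0 := by
        have : 0 ≤ n * trueError D h := by positivity
        linarith
      rw [one_div, Real.log_inv] at this
      by_contra hcon
      linarith [Real.log_nonpos hδ.le (not_le.1 hcon).le]
    exact prob_le_one.trans (by simpa using h1)
  have h₁ := pi_card_mem_le D (measurableSet_errSet hh) (n := n) hl2
    (2 * (n * trueError D h + Real.log (1 / δ)))
  refine (measure_mono fun s hs => ?_).trans (h₁.trans (ENNReal.ofReal_le_ofReal ?_))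
  · rw [Set.mem_ofPred_eq] at hs ⊢
    refine hs.le.trans (le_of_eq ?_)
    rw [errCount, countP_ofFn]
    push_cast
    exact Finset.sum_congr rfl fun i _ => if_congr Iff.rfl rfl rfl
  -- At `θ = log 2` the exponent is `a - 2 log 2 (a + log (1 / δ))` with `a` the mean; it is at most
  -- `log δ` because `2 log 2 ≥ 1` and the bracket is nonnegative.
  · rw [Real.exp_log (by norm_num)]
    have hD : D.real (errSet h) = trueError D h := rfl
    rw [hD, ← Real.le_log_iff_exp_le hδ]
    have hld : Real.log δ = - Real.log (1 / δ) := by rw [one_div, Real.log_inv, neg_neg]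
    have hl := Real.log_two_gt_d9
    rw [hld]
    nlinarith [not_lt.1 hneg]

instance (k t : ℕ) : IsProbabilityMeasure (drawLaw k t) := by
  unfold drawLaw
  infer_instance

/-- Off the bad region, it is unlikely that a fraction `11 / 243` of the drawn voters err. -/
theorem drawLaw_avgErr_le {X : Type*} (A : Learner X) (k t : ℕ) (S : List (X × Label))
    {z : X × Label} (hz : z ∉ badRegion A k S []) :
    drawLaw k t {r | 11 / 243 ≤ avgErr (drawnVoters A k S r) z} ≤
      ENNReal.ofReal (Real.exp (-(t / 9720))) := by
  classical
  set q := 27 ^ (k / 6) with hq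
  set B : Set (Fin q) := {j | allVoters A k S [] j z.1 ≠ z.2} with hB
  have hqpos : (0 : ℝ) < q := by rw [hq]; positivity
  have hBr : (uniformOn (Set.univ : Set (Fin q))).real B ≤ 10 / 243 := by
    have hcard : ((∑ j : Fin q, if allVoters A k S [] j z.1 ≠ z.2 then 1 else 0 : ℕ) : ℝ) ≤
        10 / 243 * q := by
      have : ¬ 10 * q ≤ 243 * (split k S []).countP fun L => A L z.1 ≠ z.2 := hz
      rw [countP_split_eq_sum] at this
      have h' := (not_le.1 this).le
      have h'' : (243 : ℝ) * ((∑ j : Fin q, if allVoters A k S [] j z.1 ≠ z.2 then 1 else 0 : ℕ) : ℝ)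
        ≤ 10 * q := by exact_mod_cast h'
      linarith
    have hc : (Measure.count B) =
        ((∑ j : Fin q, if allVoters A k S [] j z.1 ≠ z.2 then 1 else 0 : ℕ) : ℝ≥0∞) := by
      rw [Measure.count_apply MeasurableSet.of_discrete, Set.encard_eq_coe_toFinset_card,
        Finset.sum_boole]
      simp [hB, Set.toFinset_ofPred]
    rw [measureReal_def, uniformOn_univ, hc, ENNReal.toReal_div, Fintype.card_fin]
    simp only [ENNReal.toReal_natCast]
    rwa [div_le_iff₀ hqpos]
  -- With `θ = 1 / 20` and `exp θ - 1 ≤ 21 / 400`, the exponent per draw is at most (0.525 -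
  -- 0.55)/243 = -1/9720.
  refine (measure_mono fun r hr => ?_).trans ((pi_card_mem_le
    (uniformOn (Set.univ : Set (Fin q))) (B := B) MeasurableSet.of_discrete (n := t)
    (θ := 1 / 20) (by norm_num) (11 / 243 * t)).trans (ENNReal.ofReal_le_ofReal ?_))
  · rw [Set.mem_ofPred_eq] at hr ⊢
    refine le_of_le_of_eq (b := ∑ i, if drawnVoters A k S r i z.1 ≠ z.2 then (1 : ℝ) else 0) ?_
      (Finset.sum_congr rfl fun i _ => ?_)
    rotate_left
    · by_cases hi : drawnVoters A k S r i z.1 ≠ z.2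
      · rw [if_pos hi, if_pos (show r i ∈ B from hi)]
      · rw [if_neg hi, if_neg (show r i ∉ B from hi)]
    rcases Nat.eq_zero_or_pos t with rfl | ht
    · simp
    · rw [avgErr, le_div_iff₀ (by exact_mod_cast ht)] at hr
      exact hr
  · rw [Real.exp_le_exp]
    have hexp : Real.exp (1 / 20) - 1 ≤ 21 / 400 := by
      have := (abs_le.1 (Real.abs_exp_sub_one_sub_id_le (x := 1 / 20)
        (by rw [abs_of_pos] <;> norm_num))).2
      norm_num at this ⊢
      linarith
    have h1 : (Real.exp (1 / 20) - 1) * (uniformOn (Set.univ : Set (Fin q))).real B ≤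
        21 / 400 * (10 / 243) := by
      gcongr
    have h2 : t * ((Real.exp (1 / 20) - 1) * (uniformOn (Set.univ : Set (Fin q))).real B) ≤
        t * (21 / 400 * (10 / 243)) := by gcongr
    linarith

/-- The examples off the bad region on which a fraction `11 / 243` of the drawn voters err. -/
def drawFailure (A : Learner X) (k : ℕ) {t : ℕ} (S : List (X × Label))
    (r : Fin t → Fin (27 ^ (k / 6))) : Set (X × Label) :=
  {z | z ∉ badRegion A k S [] ∧ 11 / 243 ≤ avgErr (drawnVoters A k S r) z}

theorem measurableSet_drawFailure {A : Learner X} (hA : IsMeasurableLearner A) (k m t : ℕ) :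
    MeasurableSet {p : ((Fin m → X × Label) × (Fin t → Fin (27 ^ (k / 6)))) × (X × Label) |
      p.2 ∈ drawFailure A k (List.ofFn p.1.1) p.1.2} := by
  have hS : MeasurableList fun ω : (Fin m → X × Label) × (Fin t → Fin (27 ^ (k / 6))) =>
      List.ofFn ω.1 := MeasurableList.ofFn measurable_fst
  have h₁ := hS.measurableSet_badRegion hA (MeasurableList.const []) k
  suffices h₂ : Measurable fun p : ((Fin m → X × Label) × (Fin t → Fin (27 ^ (k / 6)))) × (X × Label) =>
      avgErr (drawnVoters A k (List.ofFn p.1.1) p.1.2) p.2 from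
    h₁.compl.inter (measurableSet_le measurable_const h₂)
  refine Measurable.div_const ?_ _
  refine Finset.measurable_fun_sum _ fun i _ => Measurable.ite ?_ measurable_const measurable_const
  have hU : {p : ((Fin m → X × Label) × (Fin t → Fin (27 ^ (k / 6)))) × (X × Label) |
      drawnVoters A k (List.ofFn p.1.1) p.1.2 i p.2.1 ≠ p.2.2} = ⋃ j,
      {p | p.1.2 i = j} ∩ {p | p.2 ∈ errSet (allVoters A k (List.ofFn p.1.1) [] j)} := by
    ext p
    simp [drawnVoters, errSet]
  rw [hU]
  refine MeasurableSet.iUnion fun j => MeasurableSet.inter ?_ ?_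
  · have hi : Measurable fun p : ((Fin m → X × Label) × (Fin t → Fin (27 ^ (k / 6)))) ×
        (X × Label) => p.1.2 i := by fun_prop
    exact hi (measurableSet_singleton j)
  · exact measurableSet_setOf_errSet
      (V := fun ω : (Fin m → X × Label) × (Fin t → Fin (27 ^ (k / 6))) =>
        allVoters A k (List.ofFn ω.1) [] j) (hS.measurable_learner hA (MeasurableList.const []) k j)

/-- By Fubini the pointwise bound over the draws bounds the expected mass of the failure set, and
Markov's inequality converts this into a bound with probability `1 - δ`. -/
theorem prod_drawFailure_le (D : Measure (X × Label)) [IsProbabilityMeasure D]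
    {A : Learner X} (hA : IsMeasurableLearner A) (k m t : ℕ) {δ : ℝ} (hδ : 0 < δ) :
    ((Measure.pi fun _ : Fin m => D).prod (drawLaw k t))
      {ω | Real.exp (-(t / 9720)) / δ < D.real (drawFailure A k (List.ofFn ω.1) ω.2)} ≤
      ENNReal.ofReal δ := by
  have hG := measurableSet_drawFailure hA k m t
  set η := Real.exp (-((t : ℝ) / 9720))
  have hη : 0 < η := Real.exp_pos _
  have hm : Measurable fun ω : (Fin m → X × Label) × (Fin t → Fin (27 ^ (k / 6))) =>
      D (drawFailure A k (List.ofFn ω.1) ω.2) := measurable_measure_prodMk_left hG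
  have hintegral : ∫⁻ ω, D (drawFailure A k (List.ofFn ω.1) ω.2)
      ∂((Measure.pi fun _ : Fin m => D).prod (drawLaw k t)) ≤ ENNReal.ofReal η := by
    rw [lintegral_prod _ hm.aemeasurable]
    calc _ ≤ ∫⁻ _s, ENNReal.ofReal η ∂(Measure.pi fun _ : Fin m => D) := by
          refine lintegral_mono fun s => ?_
          have hGs : MeasurableSet {p : (Fin t → Fin (27 ^ (k / 6))) × (X × Label) |
              p.2 ∈ drawFailure A k (List.ofFn s) p.1} :=
            (by fun_prop : Measurable fun p : (Fin t → Fin (27 ^ (k / 6))) × (X × Label) =>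
              ((s, p.1), p.2)) hG
          calc _ = ((drawLaw k t).prod D) {p | p.2 ∈ drawFailure A k (List.ofFn s) p.1} :=
                (Measure.prod_apply hGs).symm
            _ = ∫⁻ z, drawLaw k t {r | z ∈ drawFailure A k (List.ofFn s) r} ∂D :=
                Measure.prod_apply_symm hGs
            _ ≤ ∫⁻ _z, ENNReal.ofReal η ∂D := lintegral_mono fun z => by
                by_cases hz : z ∈ badRegion A k (List.ofFn s) []
                · simp [drawFailure, hz]
                · exact (measure_mono fun r hr => hr.2).trans (drawLaw_avgErr_le A k t _ hz)
            _ = ENNReal.ofReal η := by simp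
      _ = ENNReal.ofReal η := by simp
  have hpos : 0 < η / δ := by positivity
  have hsub : {ω : (Fin m → X × Label) × (Fin t → Fin (27 ^ (k / 6))) |
      η / δ < D.real (drawFailure A k (List.ofFn ω.1) ω.2)} ⊆
      {ω | ENNReal.ofReal (η / δ) ≤ D (drawFailure A k (List.ofFn ω.1) ω.2)} := by
    intro ω hω
    rw [Set.mem_ofPred_eq] at hω ⊢
    rw [← ofReal_measureReal (μ := D)]
    exact ENNReal.ofReal_le_ofReal hω.le
  have hmarkov := ((mul_le_mul_right (measure_mono hsub) _).trans
    (mul_meas_ge_le_lintegral hm _)).trans hintegral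
  rw [← ENNReal.mul_le_mul_iff_right (ENNReal.ofReal_pos.2 hpos).ne' ENNReal.ofReal_ne_top]
  refine hmarkov.trans (le_of_eq ?_)
  rw [← ENNReal.ofReal_mul hpos.le, div_mul_cancel₀ _ hδ.ne']

end Draws

theorem HasVCDim.nonempty {X : Type*} {H : Set (Hyp X)} {d : ℕ} (hd : HasVCDim H d) :
    H.Nonempty := by
  obtain ⟨F, -, hF⟩ := hd.1
  obtain ⟨h, hh, -⟩ := hF fun _ => 1
  exact ⟨h, hh⟩

/-- The required factor 4·243² exceeds 9720. If `log y ≤ 0`, the right side is at least 1. -/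
theorem exp_neg_le_of_log_le {y : ℝ} (hy : 0 < y) {t : ℕ}
    (ht : 4 * 243 ^ 2 * Real.log y ≤ t) : Real.exp (-(t / 9720)) ≤ y⁻¹ := by
  rw [← Real.le_log_iff_exp_le (inv_pos.2 hy), Real.log_inv, neg_le_neg_iff]
  have h0 : (0 : ℝ) ≤ t := Nat.cast_nonneg t
  rcases le_total (Real.log y) 0 with h | h
  · exact h.trans (by positivity)
  · rw [le_div_iff₀ (by norm_num)]
    nlinarith

/-- The deterministic part of the final bound. -/
theorem vote_bound {m τ τh L d e b g v : ℝ} (hm : 0 < m) (hL : 0 ≤ L) (hd : 0 ≤ d) (hτ : 0 ≤ τ)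
    (hv : v ≤ b + g) (hb : m * b ≤ 3 ^ 18 * (e + d + (1 + (L + 2))))
    (he : e ≤ 2 * (m * τh + (L + 2))) (hτh : τh ≤ τ + 1 / m) (hg : m * g ≤ 3 / 2 * (d + L)) :
    v ≤ 10 * 3 ^ 18 * τ + 10 * 3 ^ 18 * (d + (1 + L)) / m := by
  have h₁ : m * τh ≤ m * τ + 1 := by
    calc m * τh ≤ m * (τ + 1 / m) := by gcongr
      _ = m * τ + 1 := by field_simp
  have hmτ : 0 ≤ m * τ := by positivity
  refine hv.trans (le_of_mul_le_mul_left ?_ hm)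
  have : m * (10 * 3 ^ 18 * τ + 10 * 3 ^ 18 * (d + (1 + L)) / m) =
      10 * 3 ^ 18 * (m * τ) + 10 * 3 ^ 18 * (d + (1 + L)) := by field_simp
  rw [this, mul_add]
  linarith

end AgnosticVoting

/-! ### Assembly of the theorem -/

theorem mainTheorem3 :
    ∃ c : ℝ, 1 ≤ c ∧
      ∀ (X : Type*) [MeasurableSpace X] (H : Set (AgnosticVoting.Hyp X)) (d : ℕ),
        (∀ h ∈ H, Measurable h) → AgnosticVoting.HasVCDim H d →
      ∀ A : AgnosticVoting.Learner X,
        AgnosticVoting.IsERM H A → AgnosticVoting.IsMeasurableLearner A →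
      ∀ (D : Measure (X × AgnosticVoting.Label)) [IsProbabilityMeasure D]
        (δ : ℝ), 0 < δ → δ < 1 →
      ∀ k m : ℕ, 6 ≤ k → m = 3 ^ k →
      ∀ t : ℕ,
        4 * 243 ^ 2 * Real.log (2 * (m : ℝ) / (δ * ((d : ℝ) + Real.log (1 / δ)))) ≤ (t : ℝ) →
      1 - δ ≤
        ((Measure.pi fun _ : Fin m => D).prod (AgnosticVoting.drawLaw k t)).real
          {ω | AgnosticVoting.voteError D (11 / 243)
                  (AgnosticVoting.drawnVoters A k (List.ofFn ω.1) ω.2) ≤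
                c * AgnosticVoting.bestError D H +
                  c * ((d : ℝ) + Real.log (Real.exp 1 / δ)) / (m : ℝ)} := by
  open AgnosticVoting in
  -- With L = ln(1/δ), the estimates add up to 3^18 (2mτ + d + 3L + 9) + 3/2 (d + L) for m times the
  -- vote error, which the factor 10 absorbs.
  refine ⟨10 * 3 ^ 18, by norm_num, ?_⟩
  intro X _ H d hHm hd A hERM hA D _ δ hδ hδ1 k m _ hm t ht
  subst hm
  set m := 3 ^ k with hmdef
  have hmpos : (0 : ℝ) < m := by rw [hmdef]; positivity
  have hτ : 0 ≤ bestError D H :=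
    Real.sInf_nonneg (by rintro _ ⟨h, -, rfl⟩; exact measureReal_nonneg)
  -- The infimum need not be attained; a slack of `1 / m` costs only a constant number of expected
  -- errors.
  obtain ⟨_, ⟨h, hh, rfl⟩, hτh⟩ := exists_lt_of_csInf_lt (hd.nonempty.image (trueError D))
    (lt_add_of_pos_right (bestError D H) (one_div_pos.2 hmpos))
  have hL : 0 < Real.log (1 / δ) := Real.log_pos (by rw [lt_div_iff₀ hδ]; linarith)
  have h3 := log_inv_div_le hδ (a := 3) (n := 2) (by norm_num) (by norm_num)
  have hdL : 0 < (d : ℝ) + Real.log (1 / δ) := by positivity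
  set P := (Measure.pi fun _ : Fin m => D).prod (drawLaw k t)
  set good := {ω : (Fin m → X × Label) × (Fin t → Fin (27 ^ (k / 6))) |
    voteError D (11 / 243) (drawnVoters A k (List.ofFn ω.1) ω.2) ≤
      10 * 3 ^ 18 * bestError D H + 10 * 3 ^ 18 * ((d : ℝ) + Real.log (Real.exp 1 / δ)) / (m : ℝ)}
    with hgood
  set B₁ := {s : Fin m → X × Label | 3 ^ 18 * (errCount h (List.ofFn s ++ []) + d +
    Real.log (Real.exp 1 / (δ / 3))) < (3 : ℝ) ^ k * D.real (badRegion A k (List.ofFn s) [])}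
    with hB₁
  set B₂ := {s : Fin m → X × Label | 2 * (m * trueError D h + Real.log (1 / (δ / 3))) <
    errCount h (List.ofFn s)} with hB₂
  set B₃ := {ω : (Fin m → X × Label) × (Fin t → Fin (27 ^ (k / 6))) |
    Real.exp (-(t / 9720)) / (δ / 3) < D.real (drawFailure A k (List.ofFn ω.1) ω.2)} with hB₃
  have hδ3 : 0 < δ / 3 := by positivity
  have h₁ : P.real (B₁ ×ˢ Set.univ) ≤ δ / 3 := by
    refine ENNReal.toReal_le_of_le_ofReal hδ3.le ?_
    rw [Measure.prod_prod, measure_univ, mul_one]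
    exact pi_badRegion_le D hd hERM hA hh (hHm h hh) k [] hδ3 (by linarith)
  have h₂ : P.real (B₂ ×ˢ Set.univ) ≤ δ / 3 := by
    refine ENNReal.toReal_le_of_le_ofReal hδ3.le ?_
    rw [Measure.prod_prod, measure_univ, mul_one]
    exact pi_errCount_le D (hHm h hh) hδ3
  have h₃ : P.real B₃ ≤ δ / 3 :=
    ENNReal.toReal_le_of_le_ofReal hδ3.le (prod_drawFailure_le D hA k m t hδ3)
  -- Covering the whole space gives the lower bound on `P.real good` by subadditivity alone, without
  -- measurability of `good`.
  have hcover : Set.univ ⊆ good ∪ (B₁ ×ˢ Set.univ ∪ B₂ ×ˢ Set.univ ∪ B₃) := by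
    intro ω _
    by_contra hcon
    simp only [Set.mem_union, Set.mem_prod, Set.mem_univ, and_true, not_or] at hcon
    obtain ⟨hg, ⟨hω₁, hω₂⟩, hω₃⟩ := hcon
    rw [hB₁, Set.mem_ofPred_eq, not_lt, log_exp_one_div hδ3, List.append_nil] at hω₁
    rw [hB₂, Set.mem_ofPred_eq, not_lt] at hω₂
    rw [hB₃, Set.mem_ofPred_eq, not_lt] at hω₃
    refine hg ?_
    rw [hgood, Set.mem_ofPred_eq, log_exp_one_div hδ]
    have hη : Real.exp (-(t / 9720)) ≤ (δ * ((d : ℝ) + Real.log (1 / δ))) / (2 * m) :=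
      (exp_neg_le_of_log_le (by positivity) ht).trans_eq (inv_div _ _)
    push_cast at h3
    refine vote_bound (b := D.real (badRegion A k (List.ofFn ω.1) []))
      (g := D.real (drawFailure A k (List.ofFn ω.1) ω.2)) (e := errCount h (List.ofFn ω.1))
      (τh := trueError D h) hmpos hL.le (Nat.cast_nonneg d) hτ ?_ ?_ ?_ hτh.le ?_
    · refine (measureReal_mono (fun z hz => ?_) (by finiteness)).trans (measureReal_union_le _ _)
      by_cases hzb : z ∈ badRegion A k (List.ofFn ω.1) []
      · exact Or.inl hzb
      · exact Or.inr ⟨hzb, hz⟩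
    · rw [show (m : ℝ) = (3 : ℝ) ^ k by rw [hmdef]; push_cast; rfl]
      refine hω₁.trans ?_
      gcongr
    · refine hω₂.trans ?_
      gcongr
    · calc (m : ℝ) * D.real (drawFailure A k (List.ofFn ω.1) ω.2)
          ≤ m * ((δ * ((d : ℝ) + Real.log (1 / δ))) / (2 * m) / (δ / 3)) := by
            gcongr
            exact hω₃.trans (by gcongr)
        _ = 3 / 2 * (d + Real.log (1 / δ)) := by field_simp
  have hone : 1 ≤ P.real good + (δ / 3 + δ / 3 + δ / 3) := by
    calc (1 : ℝ) = P.real Set.univ := by simp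
      _ ≤ P.real (good ∪ (B₁ ×ˢ Set.univ ∪ B₂ ×ˢ Set.univ ∪ B₃)) :=
          measureReal_mono hcover (by finiteness)
      _ ≤ P.real good + (P.real (B₁ ×ˢ Set.univ) + P.real (B₂ ×ˢ Set.univ) + P.real B₃) := by
          refine (measureReal_union_le _ _).trans ?_
          gcongr
          refine (measureReal_union_le _ _).trans ?_
          gcongr
          exact measureReal_union_le _ _
      _ ≤ _ := by gcongr
  linarith
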